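/- **The integro-differential components of mir.** *Setting.* Let $\beta=(\beta_1,\beta_2,\dots)$ be complex numbers and $\beta(\tau)=\tau^{-1}+\sum_{k\ge1}\beta_k\tau^k$ (so $\beta_{-1}=1$, $\beta_0=0$). The standard choice is $\beta(\tau)=1/(e^{\tau/2}-e^{-\tau/2})$. Let $f(x)=\sum_{k\ge\kappa}f_kx^k\in\mathbb C[[x]]$ with $\kappa\ge 0$, $f_\kappa\ne0$, and fix a determination of $f_\kappa^{-1/(\kappa+1)}$. Put $f^*(x)=\int_0^xf$; let $g^*$ be the Puiseux series in $y^{1/(\kappa+1)}$ with $f^*\circ g^*=\mathrm{id}$ and leading term $(f_\kappa/(\kappa+1))^{-1/(\kappa+1)}y^{1/(\kappa+1)}$, and let $g=\partial g^*$. Let $$h(\nu)=\mathrm{nir}(f)(\nu)=\frac1{2\pi i}\int_{c-i\infty}^{c+i\infty}e^{n\nu}\frac{dn}n\int_0^\infty\exp\Big(-f_\kappa\frac{n^{-\kappa}\tau^{\kappa+1}}{\kappa+1}\Big)\exp_\#\Big(-\Big[\sum_{k\ge\kappa}f_kn^{-k}\beta_k^*(\tau)-f_\kappa\frac{n^{-\kappa}\tau^{\kappa+1}}{\kappa+1}\Big]\Big)d\tau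 ,$$ where $\beta_k^*(\tau)=\beta(\partial_\tau)\tau^k=\frac{\tau^{k+1}}{k+1}+\sum_{s=1}^k\beta_s\frac{k!}{(k-s)!}\tau^{k-s}$, $\exp_\#$ is expanded as a power series, and both integrations are formal and term by term: $$\int_0^\infty e^{-f_\kappa n^{-\kappa}\tau^{\kappa+1}/(\kappa+1)}\tau^pd\tau=f_\kappa^{-\frac{p+1}{\kappa+1}}(\kappa+1)^{\frac{p+1}{\kappa+1}-1}\,\Gamma\big(\tfrac{p+1}{\kappa+1}\big)\,n^{\frac{\kappa(p+1)}{\kappa+1}},\qquad \frac1{2\pi i}\int e^{n\nu}n^{-q}\frac{dn}n=\frac{\nu^q}{\Gamma(q+1)}.$$ The transform $\mathrm{mir}$ (for the given $\beta$) is the map $\bar g:=1/g\mapsto\hbar:=1/h$. *Statement.* There are polynomials $\mathrm{Mir}^{n_0,n_1,\dots}\in\mathbb Q[\beta_1,\beta_2,\dots]$, one for each finitely supported sequence $(n_0,n_1,\dots)$ of natural numbers, such that for every choice of $\beta$ and every $\bar g$ and $\hbar=\mathrm{mir}(\bar g)$ as above $$\frac1\hbar=\frac1{\bar g}+\sum_{r\ge1,\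 \frac12(r-1)\le s\le r}\partial^{-s}\,\mathbb D_{r,s}(\bar g),\qquad \mathbb D_{r,s}(\bar g)=\sum_{\sum n_i=r,\ \sum i\,n_i=s}\mathrm{Mir}^{n_0,\dots,n_s}\prod_{0\le i\le s}(\bar g^{(i)})^{n_i},$$ where $\mathrm{Mir}^{n_0,\dots,n_s}$ is evaluated at $\beta$ and vanishes unless $r=\sum n_i$, $s=\sum i\,n_i$ satisfy $r\ge1$ and $\frac12(r-1)\le s\le r$. Every $\mathbb D_{r,s}(\bar g)$ has only exponents $>-1$, $\partial^{-s}$ is $s$-fold formal integration from $0$, and the double sum converges formally. The expansion is canonical: for each fixed $\beta$, no other complex coefficients $c^{n_0,n_1,\dots}$ (vanishing unless $r\ge1$ and $\frac12(r-1)\le s\le r$) have this property for all $\bar g$. Moreover, with $r=\sum n_i$ and $s=\sum i\,n_i$: 1. $\mathrm{Mir}^{n_0,\dots,n_s}\in\frac1{s!}\mathbb Z[\beta_1,\beta_2,\dots]$. 2. $\mathrm{Mir}^{n_0,\dots,n_s}$ is homogeneous of degree $r+1$ if each $\beta_i$ has degree $i+1$, and homogeneous of order $s$ if each $\beta_i$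 has order $i$. 3. For the standard choice of $\beta$, $\mathrm{Mir}^{n_0,\dots,n_s}=0$ whenever $r$ is even, so that only odd $r$ occur in the expansion. -/

import Mathlib

open scoped Polynomial

noncomputable section

namespace MirTransform

/-! ### Calculus on generalised power series

`HahnSeries ℚ ℂ` is the field of generalised power series `∑ a_q y ^ q` with complex coefficients,
rational exponents and well-ordered support; it contains all Puiseux series. -/

/-- Formal derivation `∂`: it sends `y ^ q` to `q y ^ (q - 1)`. -/
def deriv (φ : HahnSeries ℚ ℂ) : HahnSeries ℚ ℂ where
  coeff q := ((q + 1 : ℚ) : ℂ) * φ.coeff (q + 1)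
  isPWO_support' := by
    refine (φ.isPWO_support.image_of_monotone (f := fun q : ℚ => q - 1)
      (fun a b h => by simpa using h)).mono ?_
    intro q hq
    refine ⟨q + 1, ?_, by simp⟩
    intro h
    exact hq (by simp only [h, mul_zero])

/-- Formal integration `∂⁻¹ = ∫_0`: it sends `y ^ q` to `y ^ (q + 1) / (q + 1)`.  It is meant for
series all of whose exponents are `> -1` (see `IsIntegrableAtZero`). -/
def integ (φ : HahnSeries ℚ ℂ) : HahnSeries ℚ ℂ where
  coeff q := φ.coeff (q - 1) / (q : ℂ)
  isPWO_support' := by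
    refine (φ.isPWO_support.image_of_monotone (f := fun q : ℚ => q + 1)
      (fun a b h => by simpa using h)).mono ?_
    intro q hq
    refine ⟨q - 1, ?_, by simp⟩
    intro h
    exact hq (by simp only [h, zero_div])

/-- All exponents of `φ` are `> -1`, so that `φ` has an integral from `0`. -/
def IsIntegrableAtZero (φ : HahnSeries ℚ ℂ) : Prop :=
  ∀ q : ℚ, q ≤ -1 → φ.coeff q = 0

/-! ### The choice of `β`

A choice of coefficients is a sequence `β₁, β₂, …` (indexed by `ℕ+`), standing for the series
`β(τ) = τ⁻¹ + ∑_{k ≥ 1} β_k τ ^ k`, i.e. `β_{-1} = 1` and `β_0 = 0`. -/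

/-- The standard choice: the coefficients of the Laurent series `1 / (e^{τ/2} - e^{-τ/2})`. -/
def standardBeta (k : ℕ+) : ℂ :=
  ((((PowerSeries.rescale (1 / 2 : ℂ) (PowerSeries.exp ℂ) -
      PowerSeries.rescale (-1 / 2 : ℂ) (PowerSeries.exp ℂ) : PowerSeries ℂ) :
        LaurentSeries ℂ))⁻¹).coeff (k : ℤ)

/-- The polynomial
`β*_k(τ) = β(∂_τ) τ ^ k = τ ^ (k+1) / (k+1) + ∑_{1 ≤ s ≤ k} β_s k! / (k-s)! τ ^ (k-s)`. -/
def betaPoly (β : ℕ+ → ℂ) (k : ℕ) : ℂ[X] :=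
  Polynomial.C (1 / ((k : ℂ) + 1)) * Polynomial.X ^ (k + 1) +
    ∑ s ∈ Finset.range k,
      Polynomial.C (β s.succPNat * (k.descFactorial (s + 1) : ℂ)) * Polynomial.X ^ (k - (s + 1))

/-! ### The `nir` transform

Here `f = ∑_{k ≥ κ} f_k x ^ k` with `f_κ ≠ 0`.  Double series in `z = n⁻¹` and `τ` that are
polynomial in `τ` at each order in `z` are elements of `PowerSeries ℂ[X]`: the power series
variable is `z`, the polynomial variable is `τ`. -/

/-- `f^{↑β*}(n, τ) = ∑_{k ≥ κ} f_k n⁻ᵏ β*_k(τ) - f_κ n^{-κ} τ ^ (κ+1) / (κ+1)`: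
the series `β(∂_τ) f(τ/n)` without its leading term. -/
def upArrow (β : ℕ+ → ℂ) (κ : ℕ) (f : PowerSeries ℂ) : PowerSeries ℂ[X] :=
  PowerSeries.mk fun k =>
    (if κ ≤ k then Polynomial.C (PowerSeries.coeff k f) * betaPoly β k else 0) -
      (if k = κ then
        Polynomial.C (PowerSeries.coeff κ f / ((κ : ℂ) + 1)) * Polynomial.X ^ (κ + 1) else 0)

/-- `exp_#(-A) = ∑_j (-1)^j A^j / j!` for a series `A` without constant term in `z`
(so that only `j ≤ K` contributes to the coefficient of `z ^ K`). -/
def expNeg (A : PowerSeries ℂ[X]) : PowerSeries ℂ[X] :=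
  PowerSeries.mk fun K =>
    ∑ j ∈ Finset.range (K + 1),
      Polynomial.C ((-1 : ℂ) ^ j / (j.factorial : ℂ)) * PowerSeries.coeff K (A ^ j)

/-- The exponent `q = K - κ (p+1) / (κ+1)`: term-by-term Laplace integration in `τ` turns
`n^{-K} τ ^ p` into a multiple of `n^{-q}`. -/
def nirExp (κ K p : ℕ) : ℚ := (K : ℚ) - (κ : ℚ) * ((p : ℚ) + 1) / ((κ : ℚ) + 1)

/-- The factor `f_κ^{-(p+1)/(κ+1)} (κ+1)^{(p+1)/(κ+1)-1} Γ((p+1)/(κ+1))` of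
`∫_0^∞ exp(-f_κ n^{-κ} τ^{κ+1} / (κ+1)) τ ^ p dτ`, where `ρ` is the chosen determination of
`f_κ^{-1/(κ+1)}`. -/
def laplaceFactor (κ : ℕ) (ρ : ℂ) (p : ℕ) : ℂ :=
  ρ ^ (p + 1) *
    ((((κ : ℝ) + 1) ^ (((p : ℝ) + 1) / ((κ : ℝ) + 1) - 1) *
      Real.Gamma (((p : ℝ) + 1) / ((κ : ℝ) + 1)) : ℝ) : ℂ)

/-- The coefficient of `n^{-K} τ ^ p` in `exp_#(-f^{↑β*}(n, τ))`. -/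
def nirCoeff (β : ℕ+ → ℂ) (κ : ℕ) (f : PowerSeries ℂ) (K p : ℕ) : ℂ :=
  (PowerSeries.coeff K (expNeg (upArrow β κ f))).coeff p

/-- The contribution of `n^{-K} τ ^ p` to `nir(f)`: Laplace integration in `τ`, followed by the
Borel integration `n^{-q} ↦ ν ^ q / q!` in `n`. -/
def nirTerm (β : ℕ+ → ℂ) (κ : ℕ) (f : PowerSeries ℂ) (ρ : ℂ) (K p : ℕ) : HahnSeries ℚ ℂ :=
  HahnSeries.single (nirExp κ K p)
    (nirCoeff β κ f K p * laplaceFactor κ ρ p /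
      ((Real.Gamma ((nirExp κ K p : ℝ) + 1) : ℝ) : ℂ))

/-! Summability of the terms of `nir`. -/

/-- `τ`-degree at most `(κ+2)/(κ+1)` times the order in `z`. -/
def ConeBound (κ : ℕ) (A : PowerSeries ℂ[X]) : Prop :=
  ∀ K : ℕ, (κ + 1) * (PowerSeries.coeff K A).natDegree ≤ (κ + 2) * K

theorem natDegree_betaPoly_le (β : ℕ+ → ℂ) (k : ℕ) : (betaPoly β k).natDegree ≤ k + 1 := by
  unfold betaPoly
  refine Polynomial.natDegree_add_le_of_degree_le ?_ ?_
  · exact Polynomial.natDegree_C_mul_X_pow_le _ _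
  · refine Polynomial.natDegree_sum_le_of_forall_le _ _ fun s _ => ?_
    exact (Polynomial.natDegree_C_mul_X_pow_le _ _).trans (by omega)

theorem coneBound_upArrow (β : ℕ+ → ℂ) (κ : ℕ) (f : PowerSeries ℂ) :
    ConeBound κ (upArrow β κ f) := by
  intro k
  rw [upArrow, PowerSeries.coeff_mk]
  rcases lt_trichotomy k κ with h | h | h
  · rw [if_neg (by omega), if_neg (by omega)]
    simp
  · subst h
    rw [if_pos le_rfl, if_pos rfl, betaPoly, mul_add, ← mul_assoc, ← Polynomial.C_mul, mul_one_div,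
      add_sub_cancel_left]
    have h1 : (Polynomial.C (PowerSeries.coeff k f) * ∑ s ∈ Finset.range k,
        Polynomial.C (β s.succPNat * (k.descFactorial (s + 1) : ℂ)) *
          Polynomial.X ^ (k - (s + 1))).natDegree ≤ k := by
      refine (Polynomial.natDegree_C_mul_le _ _).trans ?_
      refine Polynomial.natDegree_sum_le_of_forall_le _ _ fun s _ => ?_
      exact (Polynomial.natDegree_C_mul_X_pow_le _ _).trans (by omega)
    exact Nat.mul_le_mul (by omega) h1
  · rw [if_pos h.le, if_neg (by omega), sub_zero]
    have h1 := (Polynomial.natDegree_C_mul_le (PowerSeries.coeff k f) (betaPoly β k)).trans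
      (natDegree_betaPoly_le β k)
    have h2 : (κ + 1) * (k + 1) ≤ (κ + 2) * k := by
      have : κ + 1 ≤ k := h
      nlinarith
    exact (Nat.mul_le_mul_left _ h1).trans h2

theorem ConeBound.pow {κ : ℕ} {A : PowerSeries ℂ[X]} (h : ConeBound κ A) (j : ℕ) :
    ConeBound κ (A ^ j) := by
  induction j with
  | zero =>
    intro K
    rw [pow_zero, PowerSeries.coeff_one]
    split_ifs <;> simp
  | succ j ih =>
    intro K
    rw [pow_succ, PowerSeries.coeff_mul]
    have : (∑ p ∈ Finset.HasAntidiagonal.antidiagonal K, PowerSeries.coeff p.1 (A ^ j) *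
        PowerSeries.coeff p.2 A).natDegree ≤ (κ + 2) * K / (κ + 1) := by
      refine Polynomial.natDegree_sum_le_of_forall_le _ _ fun p hp => ?_
      refine Polynomial.natDegree_mul_le.trans ?_
      rw [Nat.le_div_iff_mul_le (Nat.succ_pos κ), mul_comm]
      have h1 := add_le_add (ih p.1) (h p.2)
      rwa [← mul_add, ← mul_add, Finset.HasAntidiagonal.mem_antidiagonal.1 hp] at h1
    calc _ ≤ (κ + 1) * ((κ + 2) * K / (κ + 1)) := Nat.mul_le_mul_left _ this
      _ ≤ _ := Nat.mul_div_le _ _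

theorem coneBound_expNeg {κ : ℕ} {A : PowerSeries ℂ[X]} (h : ConeBound κ A) :
    ConeBound κ (expNeg A) := by
  intro K
  rw [expNeg, PowerSeries.coeff_mk]
  have : (∑ j ∈ Finset.range (K + 1), Polynomial.C ((-1 : ℂ) ^ j / (j.factorial : ℂ)) *
      PowerSeries.coeff K (A ^ j)).natDegree ≤ (κ + 2) * K / (κ + 1) := by
    refine Polynomial.natDegree_sum_le_of_forall_le _ _ fun j _ => ?_
    refine (Polynomial.natDegree_C_mul_le _ _).trans ?_
    rw [Nat.le_div_iff_mul_le (Nat.succ_pos κ), mul_comm]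
    exact h.pow j K
  calc _ ≤ (κ + 1) * ((κ + 2) * K / (κ + 1)) := Nat.mul_le_mul_left _ this
    _ ≤ _ := Nat.mul_div_le _ _

theorem nirCoeff_cone {β : ℕ+ → ℂ} {κ : ℕ} {f : PowerSeries ℂ} {K p : ℕ}
    (h : nirCoeff β κ f K p ≠ 0) : (κ + 1) * p ≤ (κ + 2) * K :=
  (Nat.mul_le_mul_left _ (Polynomial.le_natDegree_of_ne_zero h)).trans
    (coneBound_expNeg (coneBound_upArrow β κ f) K)

theorem nirTerm_coeff_ne_zero {β : ℕ+ → ℂ} {κ : ℕ} {f : PowerSeries ℂ} {ρ : ℂ} {K p : ℕ} {q : ℚ}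
    (h : (nirTerm β κ f ρ K p).coeff q ≠ 0) :
    q = nirExp κ K p ∧ (κ + 1) * p ≤ (κ + 2) * K := by
  have hq : q = nirExp κ K p := by
    by_contra hne
    exact h (HahnSeries.coeff_single_of_ne hne)
  refine ⟨hq, nirCoeff_cone (β := β) (f := f) ?_⟩
  rw [nirTerm, hq, HahnSeries.coeff_single_same] at h
  intro h0
  exact h (by rw [h0, zero_mul, zero_div])

/-- The summable family of all the terms of `nir(f)`. -/
def nirFamily (β : ℕ+ → ℂ) (κ : ℕ) (f : PowerSeries ℂ) (ρ : ℂ) :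
    HahnSeries.SummableFamily ℚ ℂ (ℕ × ℕ) where
  toFun a := nirTerm β κ f ρ a.1 a.2
  isPWO_iUnion_support' := by
    have hN : (Set.univ : Set ℕ).IsPWO := Set.isPWO_of_wellQuasiOrderedLE _
    refine (hN.image_of_monotone
      (f := fun j : ℕ => ((j : ℚ) - κ) / ((κ : ℚ) + 1)) (fun a b hab => ?_)).mono ?_
    · have : (a : ℚ) ≤ b := by exact_mod_cast hab
      dsimp only
      gcongr
    · intro q hq
      obtain ⟨⟨K, p⟩, hKp⟩ := Set.mem_iUnion.1 hq
      obtain ⟨h1, h2⟩ := nirTerm_coeff_ne_zero hKp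
      have h3 : κ * p ≤ (κ + 1) * K := by nlinarith
      refine ⟨(κ + 1) * K - κ * p, Set.mem_univ _, ?_⟩
      dsimp only
      rw [h1, nirExp, Nat.cast_sub h3]
      push_cast
      field_simp
      ring
  finite_co_support' q := by
    obtain ⟨B, hB⟩ := exists_nat_gt ((q + 1) * ((κ : ℚ) + 1) ^ 2)
    refine ((Finset.range B ×ˢ Finset.range (2 * B + 1)).finite_toSet).subset ?_
    rintro ⟨K, p⟩ hKp
    obtain ⟨h1, h2⟩ := nirTerm_coeff_ne_zero hKp
    have h4 : ((κ : ℚ) + 1) * p ≤ ((κ : ℚ) + 2) * K := by exact_mod_cast h2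
    have hk : (0 : ℚ) ≤ κ := Nat.cast_nonneg κ
    have h5 : (q + 1) * ((κ : ℚ) + 1) ^ 2 =
        ((κ : ℚ) + 1) ^ 2 * K - κ * ((κ + 1) * p) + (κ + 1) := by
      rw [h1, nirExp]
      field_simp
      ring
    have h6 : (K : ℚ) < B := by
      have := mul_le_mul_of_nonneg_left h4 hk
      nlinarith
    have hK : K < B := by exact_mod_cast h6
    have hp : p ≤ 2 * K := by
      have h7 : (κ + 1) * p ≤ (κ + 1) * (2 * K) := by nlinarith
      exact Nat.le_of_mul_le_mul_left h7 (Nat.succ_pos κ)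
    simp only [Finset.coe_product, Finset.coe_range, Set.mem_prod, Set.mem_Iio]
    omega

/-- The `nir`-transform `h(ν) = (1/2πi) ∫ e^{nν} dn/n ∫_0^∞ exp^#(-f^{⇑β*}(n, τ)) dτ` of
`f = ∑_{k ≥ κ} f_k x ^ k`, with both integrations carried out term by term. -/
def nir (β : ℕ+ → ℂ) (κ : ℕ) (f : PowerSeries ℂ) (ρ : ℂ) : HahnSeries ℚ ℂ :=
  (nirFamily β κ f ρ).hsum

/-! ### The `mir` transform -/

/-- The indefinite integral `f*(x) = ∫_0^x f`. -/
def primitive (f : PowerSeries ℂ) : PowerSeries ℂ :=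
  PowerSeries.mk fun k => if k = 0 then 0 else PowerSeries.coeff (k - 1) f / (k : ℂ)

/-- `mir` is the arrow `1/g ↦ 1/h` in the chain
`f ↦ f* = ∫_0 f ↦ g* ↦ g = ∂ g*`, where `f* ∘ g* = id`, and `h = nir(f)`.
Here `f = ∑_{k ≥ κ} f_k x ^ k` with `κ ≥ 0` and `f_κ ≠ 0`, and the same determination `ρ` of
`f_κ^{-1/(κ+1)}` is used in `nir` and in the leading coefficient
`(f_κ / (κ+1))^{-1/(κ+1)}` of the Puiseux series `g*`. -/
def IsMir (β : ℕ+ → ℂ) (gbar hbar : HahnSeries ℚ ℂ) : Prop :=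
  ∃ (κ : ℕ) (f : PowerSeries ℂ) (ρ : ℂ) (gs : HahnSeries ℚ ℂ),
    (∀ k < κ, PowerSeries.coeff k f = 0) ∧
    ρ ^ (κ + 1) * PowerSeries.coeff κ f = 1 ∧
    0 < gs.orderTop ∧
    PowerSeries.heval gs (primitive f) = HahnSeries.single 1 1 ∧
    gs.leadingCoeff = ρ * ((((κ : ℝ) + 1) ^ (1 / ((κ : ℝ) + 1)) : ℝ) : ℂ) ∧
    gbar = (deriv gs)⁻¹ ∧
    hbar = (nir β κ f ρ)⁻¹

/-! ### Integro-differential expansions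

A multi-index `n = (n_0, n_1, …)` is a finitely supported function `ℕ →₀ ℕ`; it stands for the
differential monomial `∏_i (φ^{(i)}) ^ {n_i}`. -/

/-- The degree `∑ n_i`. -/
def deg (n : ℕ →₀ ℕ) : ℕ := n.sum fun _ m => m

/-- The differential order `∑ i n_i`. -/
def order (n : ℕ →₀ ℕ) : ℕ := n.sum fun i m => i * m

/-- The multi-indices with `∑ n_i = r` and `∑ i n_i = s`; these vanish beyond the index `s`. -/
def multiIndices (r s : ℕ) : Finset (ℕ →₀ ℕ) :=
  ((Finset.range (s + 1)).finsuppAntidiag r).filter fun n => order n = s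

/-- The differential operator
`D_{r,s}(φ) = ∑_{∑ n_i = r, ∑ i n_i = s} c^{n_0,…,n_s} ∏_{0 ≤ i ≤ s} (φ^{(i)}) ^ {n_i}`. -/
def diffOp (c : (ℕ →₀ ℕ) → ℂ) (r s : ℕ) (φ : HahnSeries ℚ ℂ) : HahnSeries ℚ ℂ :=
  ∑ n ∈ multiIndices r s, c n • ∏ i ∈ Finset.range (s + 1), (deriv^[i] φ) ^ n i

/-- The coefficients `c` give an expansion
`1/ħ = 1/g + ∑_{1 ≤ r, (r-1)/2 ≤ s ≤ r} ∂^{-s} D_{r,s}(g)`, for all `g` and `ħ = mir(g)`.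
All integrations are proper integrations from `0`, and the sum over `(r, s)` converges formally. -/
def IsMirExpansion (β : ℕ+ → ℂ) (c : (ℕ →₀ ℕ) → ℂ) : Prop :=
  (∀ n, c n ≠ 0 → 1 ≤ deg n ∧ deg n ≤ 2 * order n + 1 ∧ order n ≤ deg n) ∧
  ∀ gbar hbar : HahnSeries ℚ ℂ, IsMir β gbar hbar →
    (∀ r s, IsIntegrableAtZero (diffOp c r s gbar)) ∧
    ∃ F : HahnSeries.SummableFamily ℚ ℂ (ℕ × ℕ),
      (∀ r s, F (r, s) = integ^[s] (diffOp c r s gbar)) ∧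
      hbar⁻¹ = gbar⁻¹ + F.hsum

end MirTransform

end

/-! Put z = 1/n and x = τz. Since β(∂_τ) f(τz) = z⁻¹ f*(x) + ∑_{k≥1} β_k f^(k)(x) z^k, the integrand
of nir is exp(-n f*(x)) ∑_s e_s(x) z^s, where e_s is the coefficient of w^s in exp(-∑ β_k f^(k)
w^k). Under y = f*(x) the τ-integral of exp(-n f*) φ(x) becomes n ∫ e^{-ny} φ(g*(y)) g(y) dy, whose
Borel transform is φ(g*) g, and the factor n^{-s} becomes ∂^{-s}. Hence nir(f) = ∑_s ∂^{-s}(e_s(g*)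
g), which is `IsUniformizer.coeff_nir`. Formally, this change of variables is Lagrange inversion
(`IsUniformizer.coeff_heval_mul_deriv`) matched term by term with Γ(δ+j) = Γ(δ)(δ)_j
(`negBinom_mul_Gamma`).

From f(g*) g = 1 one gets f(g*) = ḡ and d/dx = ḡ d/dy, so f^(k)(g*) = (ḡ∂)^k ḡ = ḡ · ∂(ḡ∂)^{k-1} ḡ
for k ≥ 1. A product of l ≥ 1 such terms contains ḡ^l, which absorbs g = 1/ḡ. So the l-th term of
e_s(g*) g is a differential polynomial in ḡ of order s and degree r = s + l - 1, with coefficients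
(-1)^l / l! times integral polynomials in β. As β_0 = 0, only l ≤ s occurs, whence s ≤ r ≤ 2s - 1
and l! divides s!. Each term has l factors β_k with indices summing to s, which gives both
homogeneities. The standard β(τ) is odd, so only β_k of even degree k + 1 survive and r + 1 must be
even.

For uniqueness, take ḡ a power series A with A(0) ≠ 0. The coefficient of ν^s sees only orders at
most s, and at order s only the constant terms of the D_{r,s}(A), which are polynomials in the
freely prescribed derivatives of A at 0. Induction on s concludes. -/

namespace MirTransform

open HahnSeries

/-! ### Calculus of Hahn series -/

/-- All exponents of `φ` are at least `a`. -/
def VanishesBelow (φ : HahnSeries ℚ ℂ) (a : ℚ) : Prop :=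
  ∀ q < a, φ.coeff q = 0

theorem vanishesBelow_iff {φ : HahnSeries ℚ ℂ} {a : ℚ} :
    VanishesBelow φ a ↔ (a : WithTop ℚ) ≤ φ.orderTop := by
  rw [le_orderTop_iff_forall]
  simp [VanishesBelow]

namespace VanishesBelow

variable {φ ψ : HahnSeries ℚ ℂ} {a b : ℚ}

theorem mono (h : VanishesBelow φ a) (hb : b ≤ a) : VanishesBelow φ b :=
  fun q hq => h q (hq.trans_le hb)

theorem sub (h : VanishesBelow φ a) (h' : VanishesBelow ψ a) : VanishesBelow (φ - ψ) a :=
  fun q hq => by rw [coeff_sub, h q hq, h' q hq, sub_zero]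

theorem mul (h : VanishesBelow φ a) (h' : VanishesBelow ψ b) : VanishesBelow (φ * ψ) (a + b) := by
  rw [vanishesBelow_iff] at *
  exact (add_le_add h h').trans orderTop_add_le_mul

theorem one : VanishesBelow 1 0 := fun q hq => by
  rw [coeff_one, if_neg hq.ne]

theorem pow (h : VanishesBelow φ a) (n : ℕ) : VanishesBelow (φ ^ n) (n * a) := by
  induction n with
  | zero => simpa using one
  | succ n ih =>
    rw [pow_succ]
    have := ih.mul h
    push_cast
    rwa [add_mul, one_mul]

theorem coeff_mul_add (h : VanishesBelow φ a) (h' : VanishesBelow ψ b) :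
    (φ * ψ).coeff (a + b) = φ.coeff a * ψ.coeff b := by
  rw [HahnSeries.coeff_mul, Finset.sum_eq_single (a, b)]
  · rintro ⟨i, j⟩ hij hne
    rw [Finset.mem_antidiagonal] at hij
    obtain ⟨-, -, hij⟩ := hij
    dsimp only at hij ⊢
    rcases lt_trichotomy i a with hi | hi | hi
    · rw [h i hi, zero_mul]
    · exact absurd (by rw [Prod.mk.injEq]; exact ⟨hi, by linarith⟩) hne
    · rw [h' j (by linarith), mul_zero]
  · intro hab
    rw [Finset.mem_antidiagonal] at hab
    simp only [mem_support, ne_eq, and_true, not_and_or, not_not] at hab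
    rcases hab with h0 | h0 <;> rw [h0] <;> simp

theorem coeff_pow (h : VanishesBelow φ a) (n : ℕ) : (φ ^ n).coeff (n * a) = φ.coeff a ^ n := by
  induction n with
  | zero => simp
  | succ n ih =>
    rw [pow_succ, pow_succ, Nat.cast_succ, add_mul, one_mul, (h.pow n).coeff_mul_add h, ih]

theorem isIntegrableAtZero (h : VanishesBelow φ a) (ha : -1 < a) : IsIntegrableAtZero φ :=
  fun q hq => h q (hq.trans_lt ha)

end VanishesBelow

theorem eq_zero_of_forall_vanishesBelow {φ : HahnSeries ℚ ℂ} (h : ∀ n : ℕ, VanishesBelow φ n) :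
    φ = 0 := by
  ext q
  obtain ⟨n, hn⟩ := exists_nat_gt q
  exact h n q hn

@[simp]
theorem coeff_deriv (φ : HahnSeries ℚ ℂ) (q : ℚ) :
    (deriv φ).coeff q = ((q + 1 : ℚ) : ℂ) * φ.coeff (q + 1) := rfl

@[simp]
theorem coeff_integ (φ : HahnSeries ℚ ℂ) (q : ℚ) :
    (integ φ).coeff q = φ.coeff (q - 1) / (q : ℂ) := rfl

/-- The Euler operator `y ∂`. -/
def euler (φ : HahnSeries ℚ ℂ) : HahnSeries ℚ ℂ where
  coeff q := (q : ℂ) * φ.coeff q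
  isPWO_support' := φ.isPWO_support.mono fun q hq h => hq (by simp only [h, mul_zero])

@[simp]
theorem coeff_euler (φ : HahnSeries ℚ ℂ) (q : ℚ) :
    (euler φ).coeff q = (q : ℂ) * φ.coeff q := rfl

theorem support_euler_subset (φ : HahnSeries ℚ ℂ) : (euler φ).support ⊆ φ.support :=
  fun q hq h => hq (by rw [coeff_euler, h, mul_zero])

theorem deriv_eq_single_mul_euler (φ : HahnSeries ℚ ℂ) : deriv φ = single (-1) 1 * euler φ := by
  ext q
  rw [coeff_single_mul, one_mul, sub_neg_eq_add, coeff_euler, coeff_deriv]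

/-- Since y∂ preserves exponents, the Leibniz rule reduces to q = i + j on each pair of the
antidiagonal; ∂ itself would shift the index set. -/
theorem euler_mul (φ ψ : HahnSeries ℚ ℂ) : euler (φ * ψ) = euler φ * ψ + φ * euler ψ := by
  ext q
  rw [coeff_euler, coeff_add, coeff_mul, coeff_mul_left' φ.isPWO_support (support_euler_subset φ),
    coeff_mul_right' ψ.isPWO_support (support_euler_subset ψ), Finset.mul_sum,
    ← Finset.sum_add_distrib]
  refine Finset.sum_congr rfl fun ij hij => ?_
  obtain ⟨-, -, h⟩ := Finset.mem_antidiagonal.1 hij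
  rw [coeff_euler, coeff_euler, ← h]
  push_cast
  ring

theorem deriv_mul (φ ψ : HahnSeries ℚ ℂ) : deriv (φ * ψ) = deriv φ * ψ + φ * deriv ψ := by
  simp only [deriv_eq_single_mul_euler, euler_mul]
  ring

theorem deriv_add (φ ψ : HahnSeries ℚ ℂ) : deriv (φ + ψ) = deriv φ + deriv ψ := by
  ext q
  simp [mul_add]

theorem deriv_smul (c : ℂ) (φ : HahnSeries ℚ ℂ) : deriv (c • φ) = c • deriv φ := by
  ext q
  simp only [coeff_deriv, coeff_smul, smul_eq_mul]
  ring

theorem deriv_sub (φ ψ : HahnSeries ℚ ℂ) : deriv (φ - ψ) = deriv φ - deriv ψ := by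
  ext q
  simp [mul_sub]

theorem deriv_one : deriv 1 = 0 := by
  ext q
  rw [coeff_deriv, coeff_one]
  split_ifs with h
  · rw [h]; simp
  · simp

theorem deriv_pow (φ : HahnSeries ℚ ℂ) (n : ℕ) :
    deriv (φ ^ (n + 1)) = ((n : ℂ) + 1) • (φ ^ n * deriv φ) := by
  induction n with
  | zero => simp
  | succ n ih =>
    rw [pow_succ, deriv_mul, ih, pow_succ]
    simp only [← C_mul_eq_smul, Nat.cast_add, Nat.cast_one, map_add, map_one]
    ring

theorem VanishesBelow.deriv {φ : HahnSeries ℚ ℂ} {a : ℚ} (h : VanishesBelow φ a) :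
    VanishesBelow (deriv φ) (a - 1) := fun q hq => by
  rw [coeff_deriv, h _ (by linarith), mul_zero]

theorem integ_deriv {φ : HahnSeries ℚ ℂ} (h : φ.coeff 0 = 0) : integ (deriv φ) = φ := by
  ext q
  rw [coeff_integ, coeff_deriv, sub_add_cancel]
  by_cases hq : q = 0
  · rw [hq, h]; simp
  · have : (q : ℂ) ≠ 0 := by exact_mod_cast hq
    field_simp

theorem VanishesBelow.integ {φ : HahnSeries ℚ ℂ} {a : ℚ} (h : VanishesBelow φ a) :
    VanishesBelow (integ φ) (a + 1) := fun q hq => by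
  rw [coeff_integ, h _ (by linarith), zero_div]

theorem VanishesBelow.integ_iterate {φ : HahnSeries ℚ ℂ} {a : ℚ} (h : VanishesBelow φ a) (s : ℕ) :
    VanishesBelow (MirTransform.integ^[s] φ) (a + s) := by
  induction s with
  | zero => simpa using h
  | succ s ih =>
    rw [Function.iterate_succ_apply']
    refine ih.integ.mono ?_
    push_cast
    linarith

/-! ### Substitution of a Hahn series into a power series -/

theorem vanishesBelow_heval {x : HahnSeries ℚ ℂ} (hx : 0 < x.orderTop) (φ : PowerSeries ℂ) :
    VanishesBelow (PowerSeries.heval x φ) 0 := by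
  intro q hq
  rw [PowerSeries.coeff_heval]
  refine finsum_eq_zero_of_forall_eq_zero fun n => ?_
  rw [SummableFamily.coeff_apply, SummableFamily.powerSeriesFamily_of_orderTop_pos hx, coeff_smul]
  have : VanishesBelow x 0 := vanishesBelow_iff.2 hx.le
  rw [this.pow n q (by simpa using hq), smul_zero]

theorem exists_pos_vanishesBelow {x : HahnSeries ℚ ℂ} (hx : 0 < x.orderTop) :
    ∃ ω : ℚ, 0 < ω ∧ VanishesBelow x ω := by
  by_cases h : x = 0
  · exact ⟨1, one_pos, fun q _ => by rw [h, coeff_zero]⟩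
  · refine ⟨x.order, (zero_lt_orderTop_iff h).1 hx, fun q hq => coeff_eq_zero_of_lt_order hq⟩

/-- The defect E of the chain rule satisfies E(Xψ + c) = x E(ψ). Peeling n coefficients off φ raises
its order by n times a positive exponent, so it vanishes to every order. -/
theorem deriv_heval {x : HahnSeries ℚ ℂ} (hx : 0 < x.orderTop) (φ : PowerSeries ℂ) :
    deriv (PowerSeries.heval x φ) =
      PowerSeries.heval x (PowerSeries.derivative ℂ φ) * deriv x := by
  obtain ⟨ω, hω, hxω⟩ := exists_pos_vanishesBelow hx
  set E : PowerSeries ℂ → HahnSeries ℚ ℂ := fun φ =>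
    deriv (PowerSeries.heval x φ) - PowerSeries.heval x (PowerSeries.derivative ℂ φ) * deriv x
    with hE
  have hstep : ∀ ψ c, E (PowerSeries.X * ψ + PowerSeries.C c) = x * E ψ := by
    intro ψ c
    simp only [hE, map_add, map_mul, PowerSeries.heval_X x hx, PowerSeries.heval_C, deriv_add,
      deriv_smul, deriv_one, deriv_mul, Derivation.leibniz, PowerSeries.derivative_C,
      PowerSeries.derivative_X, smul_eq_mul, map_zero, map_one]
    simp only [smul_zero]
    ring
  have hbound : ∀ n : ℕ, ∀ φ, VanishesBelow (E φ) (n * ω - 1) := by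
    intro n
    induction n with
    | zero =>
      intro φ
      refine VanishesBelow.sub ?_ ?_
      · exact (vanishesBelow_heval hx φ).deriv.mono (by simp)
      · exact ((vanishesBelow_heval hx _).mul hxω.deriv).mono (by simp; linarith)
    | succ n ih =>
      intro φ
      rw [PowerSeries.eq_X_mul_shift_add_const φ, hstep]
      exact (hxω.mul (ih _)).mono (by push_cast; linarith)
  refine sub_eq_zero.1 (eq_zero_of_forall_vanishesBelow fun n => ?_)
  obtain ⟨N, hN⟩ := exists_nat_gt ((n + 1) / ω)
  refine (hbound N φ).mono ?_
  rw [div_lt_iff₀ hω] at hN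
  linarith

end MirTransform

/-! ### Lagrange inversion for the Puiseux series g*. -/

namespace MirTransform

open HahnSeries

/-! ### The series `g*` -/

/-- `gs` is the Puiseux series `g*` attached to `f` and the determination `ρ`. -/
structure IsUniformizer (κ : ℕ) (f : PowerSeries ℂ) (ρ : ℂ) (gs : HahnSeries ℚ ℂ) : Prop where
  coeff_eq_zero : ∀ k < κ, PowerSeries.coeff k f = 0
  root : ρ ^ (κ + 1) * PowerSeries.coeff κ f = 1
  pos : 0 < gs.orderTop
  heval_primitive : PowerSeries.heval gs (primitive f) = single 1 1
  leadingCoeff : gs.leadingCoeff = ρ * ((((κ : ℝ) + 1) ^ (1 / ((κ : ℝ) + 1)) : ℝ) : ℂ)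

/-- The leading coefficient `f_κ / (κ + 1)` of `∫_0 f`. -/
noncomputable def primLead (κ : ℕ) (f : PowerSeries ℂ) : ℂ :=
  PowerSeries.coeff κ f / ((κ : ℂ) + 1)

/-- The series `u` without constant term such that
`∫_0 f = f_κ / (κ + 1) * x ^ (κ + 1) * (1 + u)`. -/
noncomputable def relTail (κ : ℕ) (f : PowerSeries ℂ) : PowerSeries ℂ :=
  PowerSeries.mk fun l =>
    if l = 0 then 0 else PowerSeries.coeff (κ + l) f / ((κ : ℂ) + l + 1) / primLead κ f

theorem derivative_primitive (f : PowerSeries ℂ) :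
    PowerSeries.derivative ℂ (primitive f) = f := by
  ext n
  rw [PowerSeries.coeff_derivative, primitive, PowerSeries.coeff_mk, if_neg n.succ_ne_zero,
    Nat.add_sub_cancel, Nat.cast_succ]
  exact div_mul_cancel₀ _ (Nat.cast_add_one_ne_zero n)

theorem constantCoeff_relTail (κ : ℕ) (f : PowerSeries ℂ) :
    PowerSeries.constantCoeff (relTail κ f) = 0 := by
  rw [← PowerSeries.coeff_zero_eq_constantCoeff_apply, relTail, PowerSeries.coeff_mk, if_pos rfl]

theorem primitive_eq {κ : ℕ} {f : PowerSeries ℂ} (h : ∀ k < κ, PowerSeries.coeff k f = 0)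
    (hf : PowerSeries.coeff κ f ≠ 0) :
    primitive f =
      PowerSeries.C (primLead κ f) * (PowerSeries.X ^ (κ + 1) * (1 + relTail κ f)) := by
  have hκ : (κ : ℂ) + 1 ≠ 0 := Nat.cast_add_one_ne_zero κ
  ext n
  rw [PowerSeries.coeff_C_mul, PowerSeries.coeff_X_pow_mul', primitive, PowerSeries.coeff_mk]
  rcases n with _ | n
  · simp
  rw [if_neg n.succ_ne_zero, Nat.add_sub_cancel]
  split_ifs with hn
  · obtain ⟨l, rfl⟩ := Nat.exists_eq_add_of_le (Nat.le_of_succ_le_succ hn)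
    rw [show κ + l + 1 - (κ + 1) = l by omega, map_add, relTail, PowerSeries.coeff_mk,
      PowerSeries.coeff_one]
    have hl : (κ : ℂ) + l + 1 ≠ 0 := by
      rw [← Nat.cast_add]; exact Nat.cast_add_one_ne_zero _
    unfold primLead
    split_ifs with h0
    · subst h0; simp
    · push_cast
      field_simp
      ring
  · rw [h n (by omega)]; simp

namespace IsUniformizer

variable {κ : ℕ} {f : PowerSeries ℂ} {ρ : ℂ} {gs : HahnSeries ℚ ℂ}

theorem coeff_ne_zero (h : IsUniformizer κ f ρ gs) : PowerSeries.coeff κ f ≠ 0 :=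
  right_ne_zero_of_mul_eq_one h.root

theorem primLead_ne_zero (h : IsUniformizer κ f ρ gs) : primLead κ f ≠ 0 :=
  div_ne_zero h.coeff_ne_zero (Nat.cast_add_one_ne_zero κ)

theorem primitive_eq (h : IsUniformizer κ f ρ gs) :
    primitive f =
      PowerSeries.C (primLead κ f) * (PowerSeries.X ^ (κ + 1) * (1 + relTail κ f)) :=
  MirTransform.primitive_eq h.coeff_eq_zero h.coeff_ne_zero

/-- Differentiate f*(g*) = y. This is the identity f(g*) = 1/g = ḡ. -/
theorem heval_mul_deriv (h : IsUniformizer κ f ρ gs) :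
    PowerSeries.heval gs f * deriv gs = 1 := by
  have := deriv_heval h.pos (primitive f)
  rw [derivative_primitive, h.heval_primitive] at this
  rw [← this]
  ext q
  rw [coeff_deriv, coeff_one, coeff_single]
  by_cases hq : q = 0
  · simp [hq]
  · rw [if_neg (by simpa using hq), if_neg hq, mul_zero]

theorem order_eq (h : IsUniformizer κ f ρ gs) : gs ≠ 0 ∧ gs.order = 1 / ((κ : ℚ) + 1) := by
  have h1 := h.heval_primitive
  rw [h.primitive_eq, map_mul, map_mul, map_pow, PowerSeries.heval_X gs h.pos,
    PowerSeries.heval_C, ← C_mul_eq_smul, mul_one] at h1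
  set w := PowerSeries.heval gs (1 + relTail κ f)
  have hw0 : w.coeff 0 = 1 := by
    rw [PowerSeries.coeff_heval_zero, map_add, constantCoeff_relTail]
    simp
  have hw : w ≠ 0 := fun h0 => by simp [h0] at hw0
  have hwo : w.order = 0 := by
    apply le_antisymm
    · exact order_le_of_coeff_ne_zero (by rw [hw0]; exact one_ne_zero)
    · rw [le_order_iff_forall hw]
      exact fun q hq => vanishesBelow_heval h.pos _ q hq
  have hgs : gs ≠ 0 := by
    rintro rfl
    rw [zero_pow κ.succ_ne_zero, zero_mul, mul_zero] at h1
    simpa using (single_ne_zero (a := (1 : ℚ)) (one_ne_zero (α := ℂ))) h1.symm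
  refine ⟨hgs, ?_⟩
  have h2 := congrArg HahnSeries.order h1
  rw [order_mul (C_ne_zero h.primLead_ne_zero) (mul_ne_zero (pow_ne_zero _ hgs) hw),
    order_mul (pow_ne_zero _ hgs) hw, order_pow, hwo, order_C, order_single one_ne_zero,
    nsmul_eq_mul] at h2
  have hκ : (κ : ℚ) + 1 ≠ 0 := Nat.cast_add_one_ne_zero κ
  push_cast at h2
  field_simp
  linarith

theorem vanishesBelow (h : IsUniformizer κ f ρ gs) : VanishesBelow gs (1 / ((κ : ℚ) + 1)) :=
  fun _ hq => coeff_eq_zero_of_lt_order (hq.trans_eq h.order_eq.2.symm)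

theorem coeff_inv_succ (h : IsUniformizer κ f ρ gs) :
    gs.coeff (1 / ((κ : ℚ) + 1)) = ρ * ((((κ : ℝ) + 1) ^ (1 / ((κ : ℝ) + 1)) : ℝ) : ℂ) := by
  rw [← h.leadingCoeff, ← h.order_eq.2, leadingCoeff_eq]

theorem vanishesBelow_deriv (h : IsUniformizer κ f ρ gs) :
    VanishesBelow (deriv gs) (1 / ((κ : ℚ) + 1) - 1) := h.vanishesBelow.deriv

theorem vanishesBelow_pow_mul_deriv (h : IsUniformizer κ f ρ gs) (m : ℕ) :
    VanishesBelow (gs ^ m * deriv gs) (((m : ℚ) + 1) / ((κ : ℚ) + 1) - 1) :=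
  ((h.vanishesBelow.pow m).mul h.vanishesBelow_deriv).mono (le_of_eq (by ring))

theorem coeff_pow_mul_deriv_lead (h : IsUniformizer κ f ρ gs) (m : ℕ) :
    (gs ^ m * deriv gs).coeff (((m : ℚ) + 1) / ((κ : ℚ) + 1) - 1) =
      ρ ^ (m + 1) * ((((κ : ℝ) + 1) ^ (((m : ℝ) + 1) / ((κ : ℝ) + 1) - 1) : ℝ) : ℂ) := by
  have hκ : (0 : ℝ) < (κ : ℝ) + 1 := by positivity
  have hκ' : (κ : ℂ) + 1 ≠ 0 := Nat.cast_add_one_ne_zero κ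
  rw [show ((m : ℚ) + 1) / ((κ : ℚ) + 1) - 1 =
      (m : ℚ) * (1 / ((κ : ℚ) + 1)) + (1 / ((κ : ℚ) + 1) - 1) by ring,
    (h.vanishesBelow.pow m).coeff_mul_add h.vanishesBelow_deriv, h.vanishesBelow.coeff_pow,
    coeff_deriv, sub_add_cancel, h.coeff_inv_succ, Real.rpow_sub hκ, Real.rpow_one,
    show ((m : ℝ) + 1) / ((κ : ℝ) + 1) = (1 / ((κ : ℝ) + 1)) * ((m + 1 : ℕ) : ℝ) by
      push_cast; ring, Real.rpow_mul hκ.le, Real.rpow_natCast]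
  push_cast
  field_simp
  ring

/-- The Taylor expansion of φ with explicit remainder: for N large the remainder misses any given
exponent, so each coefficient of the left side is a finite sum. -/
theorem heval_mul_pow_mul_deriv (h : IsUniformizer κ f ρ gs) (φ : PowerSeries ℂ) (m N : ℕ) :
    PowerSeries.heval gs φ * (gs ^ m * deriv gs) =
      ∑ l ∈ Finset.range N, PowerSeries.coeff l φ • (gs ^ (m + l) * deriv gs) +
        PowerSeries.heval gs (PowerSeries.mk fun i => PowerSeries.coeff (i + N) φ) *
          (gs ^ (m + N) * deriv gs) := by
  induction N with
  | zero =>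
    simp only [Finset.range_zero, Finset.sum_empty, add_zero, zero_add]
    congr 2
    ext; simp
  | succ N ih =>
    rw [ih, Finset.sum_range_succ, add_assoc]
    congr 1
    rw [PowerSeries.eq_X_mul_shift_add_const (PowerSeries.mk fun i => PowerSeries.coeff (i + N) φ)]
    simp only [map_add, map_mul, PowerSeries.heval_X gs h.pos, PowerSeries.heval_C,
      PowerSeries.coeff_mk, ← C_mul_eq_smul, ← PowerSeries.coeff_zero_eq_constantCoeff_apply,
      zero_add]
    rw [show (fun i => PowerSeries.coeff (i + 1 + N) φ) =
      fun i => PowerSeries.coeff (i + (N + 1)) φ from funext fun i => by congr 2; ring]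
    ring

theorem coeff_heval_mul_pow_mul_deriv (h : IsUniformizer κ f ρ gs) (φ : PowerSeries ℂ) {m N : ℕ}
    {e : ℚ} (he : e < ((m : ℚ) + N + 1) / ((κ : ℚ) + 1) - 1) :
    (PowerSeries.heval gs φ * (gs ^ m * deriv gs)).coeff e =
      ∑ l ∈ Finset.range N, PowerSeries.coeff l φ * (gs ^ (m + l) * deriv gs).coeff e := by
  rw [h.heval_mul_pow_mul_deriv φ m N, coeff_add, coeff_sum,
    ((vanishesBelow_heval h.pos _).mul (h.vanishesBelow_pow_mul_deriv (m + N))) e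
      (by push_cast; linarith), add_zero]
  simp

/-- Differentiating f* = c x^(κ+1) (1 + u) gives x f = (κ+1) f* + c x^(κ+1) · x u'. Substitute g*,
multiply by g*^m ∂g*, and use f(g*) ∂g* = 1. -/
theorem single_mul_pow_mul_deriv (h : IsUniformizer κ f ρ gs) (m : ℕ) :
    HahnSeries.C ((κ : ℂ) + 1) * (single 1 1 * (gs ^ m * deriv gs)) =
      gs ^ (m + 1) - HahnSeries.C (primLead κ f) *
        (PowerSeries.heval gs (PowerSeries.X * PowerSeries.derivative ℂ (relTail κ f)) *
          (gs ^ (m + κ + 1) * deriv gs)) := by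
  have h1 : PowerSeries.X * f = PowerSeries.C ((κ : ℂ) + 1) * primitive f +
      PowerSeries.C (primLead κ f) * (PowerSeries.X ^ (κ + 1) *
        (PowerSeries.X * PowerSeries.derivative ℂ (relTail κ f))) := by
    conv_lhs => rw [← derivative_primitive f]
    rw [h.primitive_eq]
    simp only [Derivation.leibniz, PowerSeries.derivative_C, map_add, PowerSeries.derivative_pow,
      PowerSeries.derivative_X, PowerSeries.derivative_one, smul_eq_mul, Nat.add_sub_cancel]
    push_cast
    simp only [map_natCast, map_one]
    ring
  have h2 := congrArg (PowerSeries.heval gs) h1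
  simp only [map_add, map_mul, map_pow, PowerSeries.heval_X gs h.pos, PowerSeries.heval_C,
    h.heval_primitive] at h2
  simp only [← C_mul_eq_smul, mul_one] at h2
  rw [map_mul, PowerSeries.heval_X gs h.pos]
  have h3 := h.heval_mul_deriv
  simp only [map_add, map_natCast, map_one] at h2 ⊢
  linear_combination (gs ^ (m + 1)) * h3 + (-(gs ^ m * deriv gs)) * h2

/-- Compare coefficients of y^(d/(κ+1)) in the previous identity and eliminate g*^(m+1) through
∂(g*^(m+1)) = (m+1) g*^m ∂g*. The bound `hN` ensures that the terms l ≥ N do not reach this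
exponent. -/
theorem coeff_pow_mul_deriv_rec (h : IsUniformizer κ f ρ gs) {m N : ℕ} {d : ℚ} (hd : d ≠ 0)
    (hN : d < m + 1 + N) :
    ((d : ℂ) - m - 1) * (gs ^ m * deriv gs).coeff (d / ((κ : ℚ) + 1) - 1) =
      -((d : ℂ) * primLead κ f / ((κ : ℂ) + 1)) * ∑ l ∈ Finset.range N,
        ((l : ℂ) * PowerSeries.coeff l (relTail κ f)) *
          (gs ^ (m + κ + 1 + l) * deriv gs).coeff ((d + κ + 1) / ((κ : ℚ) + 1) - 1) := by
  have hκ : (κ : ℚ) + 1 ≠ 0 := Nat.cast_add_one_ne_zero κ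
  have hκ1 : (0 : ℚ) < (κ : ℚ) + 1 := by positivity
  have hκ' : (κ : ℂ) + 1 ≠ 0 := Nat.cast_add_one_ne_zero κ
  have hd' : (d : ℂ) ≠ 0 := by exact_mod_cast hd
  have hm : (m : ℂ) + 1 ≠ 0 := Nat.cast_add_one_ne_zero m
  have h1 := congrArg (fun φ => φ.coeff (d / ((κ : ℚ) + 1))) (h.single_mul_pow_mul_deriv m)
  have h2 := congrArg (fun φ => φ.coeff (d / ((κ : ℚ) + 1) - 1)) (deriv_pow gs m)
  simp only [coeff_deriv, coeff_smul, sub_add_cancel, smul_eq_mul] at h2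
  simp only [C_mul_eq_smul, coeff_smul, coeff_sub, smul_eq_mul, coeff_single_mul, one_mul] at h1
  have e1 : (d + κ + 1) / ((κ : ℚ) + 1) - 1 = d / ((κ : ℚ) + 1) := by field_simp; ring
  have hlt : d / ((κ : ℚ) + 1) < (((m + κ + 1 : ℕ) : ℚ) + N + 1) / ((κ : ℚ) + 1) - 1 := by
    rw [← e1, sub_lt_sub_iff_right, div_lt_div_iff_of_pos_right hκ1]
    push_cast
    linarith
  rw [h.coeff_heval_mul_pow_mul_deriv _ hlt] at h1
  have h3 : ∀ l, PowerSeries.coeff l (PowerSeries.X * PowerSeries.derivative ℂ (relTail κ f)) =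
      (l : ℂ) * PowerSeries.coeff l (relTail κ f) := by
    intro l
    rcases l with _ | l
    · simp
    · rw [PowerSeries.coeff_succ_X_mul, PowerSeries.coeff_derivative, mul_comm]
      push_cast; rfl
  simp only [h3] at h1
  rw [e1]
  set S := ∑ l ∈ Finset.range N, ((l : ℂ) * PowerSeries.coeff l (relTail κ f)) *
          (gs ^ (m + κ + 1 + l) * deriv gs).coeff (d / ((κ : ℚ) + 1))
  set t := (gs ^ m * deriv gs).coeff (d / ((κ : ℚ) + 1) - 1)
  set p := (gs ^ (m + 1)).coeff (d / ((κ : ℚ) + 1))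
  push_cast at h2
  field_simp at h2 ⊢
  linear_combination (d : ℂ) * h1 + h2

end IsUniformizer

/-! ### The binomial series -/

/-- The coefficient `(-1) ^ j (δ)_j / j!` of `u ^ j` in `(1 + u) ^ (-δ)`. -/
noncomputable def negBinom (δ : ℂ) (j : ℕ) : ℂ :=
  (-1) ^ j / (j.factorial : ℂ) * ∏ i ∈ Finset.range j, (δ + i)

theorem negBinom_succ (δ : ℂ) (j : ℕ) :
    ((j : ℂ) + 1) * negBinom δ (j + 1) = -δ * negBinom (δ + 1) j := by
  have h1 : (j : ℂ) + 1 ≠ 0 := Nat.cast_add_one_ne_zero j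
  have h2 : (j.factorial : ℂ) ≠ 0 := by exact_mod_cast j.factorial_ne_zero
  have h3 : ∏ i ∈ Finset.range j, (δ + ((i : ℂ) + 1)) = ∏ i ∈ Finset.range j, (δ + 1 + i) :=
    Finset.prod_congr rfl fun i _ => by ring
  rw [negBinom, negBinom, Finset.prod_range_succ', Nat.factorial_succ]
  push_cast
  rw [h3]
  field_simp
  ring

/-- The partial sum of the expansion of `(1 + u) ^ (-δ)` in powers of `u`. -/
noncomputable def negPowSum (u : PowerSeries ℂ) (N : ℕ) (δ : ℂ) : PowerSeries ℂ :=
  ∑ j ∈ Finset.range N, PowerSeries.C (negBinom δ j) * u ^ j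

/-- The coefficients of `(1 + u) ^ (-δ)`. -/
noncomputable def negPowCoeff (u : PowerSeries ℂ) (δ : ℂ) (n : ℕ) : ℂ :=
  PowerSeries.coeff n (negPowSum u (n + 1) δ)

theorem coeff_pow_eq_zero {u : PowerSeries ℂ} (hu : PowerSeries.constantCoeff u = 0) {n j : ℕ}
    (h : n < j) : PowerSeries.coeff n (u ^ j) = 0 :=
  PowerSeries.X_pow_dvd_iff.1 (pow_dvd_pow_of_dvd (PowerSeries.X_dvd_iff.2 hu) j) n h

theorem coeff_negPowSum {u : PowerSeries ℂ} (hu : PowerSeries.constantCoeff u = 0) {n N : ℕ}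
    (h : n < N) (δ : ℂ) : PowerSeries.coeff n (negPowSum u N δ) = negPowCoeff u δ n := by
  rw [negPowCoeff, negPowSum, negPowSum, map_sum, map_sum]
  refine (Finset.sum_subset (Finset.range_mono h) fun j _ hj => ?_).symm
  rw [PowerSeries.coeff_C_mul, coeff_pow_eq_zero hu (by simpa using hj), mul_zero]

theorem derivative_negPowSum (u : PowerSeries ℂ) (N : ℕ) (δ : ℂ) :
    PowerSeries.derivative ℂ (negPowSum u (N + 1) δ) =
      PowerSeries.C (-δ) * (PowerSeries.derivative ℂ u * negPowSum u N (δ + 1)) := by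
  rw [negPowSum, Finset.sum_range_succ', map_add, map_sum, negPowSum, Finset.mul_sum,
    Finset.mul_sum]
  simp only [pow_zero, mul_one, PowerSeries.derivative_C, add_zero]
  refine Finset.sum_congr rfl fun j _ => ?_
  rw [Derivation.leibniz, PowerSeries.derivative_C, PowerSeries.derivative_pow, smul_zero, add_zero,
    Nat.add_sub_cancel, smul_eq_mul]
  have := congrArg (PowerSeries.C (R := ℂ)) (negBinom_succ δ j)
  simp only [map_mul, map_add, map_natCast, map_one] at this
  push_cast
  linear_combination (u ^ j * PowerSeries.derivative ℂ u) * this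

/-- Coefficient form of x ∂(1+u)^(-δ) = -δ x u' (1+u)^(-δ-1), the same recursion as in
`IsUniformizer.coeff_pow_mul_deriv_rec`. -/
theorem natCast_mul_negPowCoeff {u : PowerSeries ℂ} (hu : PowerSeries.constantCoeff u = 0)
    (δ : ℂ) (n : ℕ) :
    (n : ℂ) * negPowCoeff u δ n = -δ * ∑ l ∈ Finset.range (n + 1),
      ((l : ℂ) * PowerSeries.coeff l u) * negPowCoeff u (δ + 1) (n - l) := by
  have h3 : ∀ (v : PowerSeries ℂ) l,
      PowerSeries.coeff l (PowerSeries.X * PowerSeries.derivative ℂ v) =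
      (l : ℂ) * PowerSeries.coeff l v := by
    intro v l
    rcases l with _ | l
    · simp
    · rw [PowerSeries.coeff_succ_X_mul, PowerSeries.coeff_derivative, mul_comm]
      push_cast; rfl
  have h := congrArg (fun φ => PowerSeries.coeff n (PowerSeries.X * φ))
    (derivative_negPowSum u (n + 1) δ)
  rw [h3, coeff_negPowSum hu (by omega), mul_left_comm, ← mul_assoc PowerSeries.X,
    PowerSeries.coeff_C_mul, PowerSeries.coeff_mul,
    Finset.Nat.sum_antidiagonal_eq_sum_range_succ_mk] at h
  rw [h]
  congr 1
  refine Finset.sum_congr rfl fun l _ => ?_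
  rw [h3, coeff_negPowSum hu (by omega)]

/-! ### The coefficients of `g*^m ∂g*` -/

/-- The factor `ρ ^ d (κ + 1) ^ (d / (κ + 1) - 1)`. -/
noncomputable def rootPow (κ : ℕ) (ρ : ℂ) (d : ℕ) : ℂ :=
  ρ ^ d * ((((κ : ℝ) + 1) ^ ((d : ℝ) / ((κ : ℝ) + 1) - 1) : ℝ) : ℂ)

theorem rootPow_add {κ : ℕ} {f : PowerSeries ℂ} {ρ : ℂ}
    (h : ρ ^ (κ + 1) * PowerSeries.coeff κ f = 1) (d : ℕ) :
    rootPow κ ρ d = primLead κ f * rootPow κ ρ (d + (κ + 1)) := by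
  have hκ : (0 : ℝ) < (κ : ℝ) + 1 := by positivity
  have hκ' : (κ : ℂ) + 1 ≠ 0 := Nat.cast_add_one_ne_zero κ
  have e1 : ((d + (κ + 1) : ℕ) : ℝ) / ((κ : ℝ) + 1) - 1 = (d : ℝ) / ((κ : ℝ) + 1) - 1 + 1 := by
    push_cast
    field_simp
    ring
  rw [rootPow, rootPow, e1, Real.rpow_add_one hκ.ne', _root_.pow_add, primLead]
  generalize ((κ : ℝ) + 1) ^ ((d : ℝ) / ((κ : ℝ) + 1) - 1) = w
  push_cast
  field_simp
  linear_combination -(ρ ^ d * (w : ℂ)) * h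

namespace IsUniformizer

variable {κ : ℕ} {f : PowerSeries ℂ} {ρ : ℂ} {gs : HahnSeries ℚ ℂ}

/-- Lagrange inversion: both sides satisfy one recursion. It replaces m by m+κ+1+l and n by n-l,
which raises the exponent δ = (m+1+n)/(κ+1) by exactly 1 for every l. The l = 0 term carries the
factor l, hence vanishes, so strong induction on n closes; n = 0 is the leading coefficient. -/
theorem coeff_pow_mul_deriv (h : IsUniformizer κ f ρ gs) (n m : ℕ) :
    (gs ^ m * deriv gs).coeff (((m + 1 + n : ℕ) : ℚ) / ((κ : ℚ) + 1) - 1) =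
      rootPow κ ρ (m + 1 + n) *
        negPowCoeff (relTail κ f) (((m + 1 + n : ℕ) : ℂ) / ((κ : ℂ) + 1)) n := by
  have hκ' : (κ : ℂ) + 1 ≠ 0 := Nat.cast_add_one_ne_zero κ
  have hu := constantCoeff_relTail κ f
  induction n using Nat.strong_induction_on generalizing m with
  | _ n ih =>
  rcases Nat.eq_zero_or_pos n with rfl | hn
  · have := h.coeff_pow_mul_deriv_lead m
    rw [add_zero]
    push_cast
    rw [this, rootPow, negPowCoeff, negPowSum]
    simp [negBinom]
  · have hn' : (n : ℂ) ≠ 0 := by exact_mod_cast hn.ne'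
    refine mul_left_cancel₀ hn' ?_
    have h1 := h.coeff_pow_mul_deriv_rec (m := m) (N := n + 1) (d := ((m + 1 + n : ℕ) : ℚ))
      (by positivity) (by push_cast; linarith)
    have h2 : ((((m + 1 + n : ℕ) : ℚ) : ℂ) - m - 1) = n := by push_cast; ring
    rw [h2] at h1
    rw [h1, mul_left_comm, natCast_mul_negPowCoeff hu, rootPow_add h.root, Finset.mul_sum,
      Finset.mul_sum, Finset.mul_sum]
    refine Finset.sum_congr rfl fun l hl => ?_
    rcases Nat.eq_zero_or_pos l with rfl | hl0
    · simp
    have hln : l ≤ n := Nat.lt_succ_iff.1 (Finset.mem_range.1 hl)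
    have h3 := ih (n - l) (by omega) (m + κ + 1 + l)
    have e1 : m + κ + 1 + l + 1 + (n - l) = m + 1 + n + (κ + 1) := by omega
    rw [e1] at h3
    have e2 : ((m + 1 + n + (κ + 1) : ℕ) : ℚ) = ((m + 1 + n : ℕ) : ℚ) + κ + 1 := by
      push_cast; ring
    have e3 : ((m + 1 + n + (κ + 1) : ℕ) : ℂ) / ((κ : ℂ) + 1) =
        ((m + 1 + n : ℕ) : ℂ) / ((κ : ℂ) + 1) + 1 := by
      push_cast
      field_simp
    rw [e2, e3] at h3
    rw [h3]
    push_cast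
    ring

/-- The same recursion, now with d - m - 1 ≠ 0. The terms with l ≥ 1 lie closer to their leading
exponent, so an upper bound on d - m - 1 serves for the induction. -/
theorem coeff_pow_mul_deriv_eq_zero (h : IsUniformizer κ f ρ gs) {m : ℕ} {d : ℚ}
    (hd : ∀ n : ℕ, d ≠ m + 1 + n) :
    (gs ^ m * deriv gs).coeff (d / ((κ : ℚ) + 1) - 1) = 0 := by
  have hκ1 : (0 : ℚ) < (κ : ℚ) + 1 := by positivity
  have key : ∀ (N m : ℕ) (d : ℚ), d < m + 1 + N → (∀ n : ℕ, d ≠ m + 1 + n) →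
      (gs ^ m * deriv gs).coeff (d / ((κ : ℚ) + 1) - 1) = 0 := by
    intro N
    induction N with
    | zero =>
      intro m d hN _
      refine h.vanishesBelow_pow_mul_deriv m _ ?_
      gcongr
      simpa using hN
    | succ N ih =>
      intro m d hN hd
      rcases lt_or_ge d (m + 1 + N) with h1 | h1
      · exact ih m d h1 hd
      have hpos : 0 < d := lt_of_lt_of_le (by positivity) h1
      have h2 := h.coeff_pow_mul_deriv_rec hpos.ne' hN
      rw [Finset.sum_eq_zero, mul_zero] at h2
      · refine (mul_eq_zero.1 h2).resolve_left fun h3 => hd 0 ?_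
        have h4 : (d : ℂ) = ((m + 1 + (0 : ℕ) : ℚ) : ℂ) := by
          push_cast; linear_combination h3
        exact_mod_cast h4
      · intro l hl
        rcases Nat.eq_zero_or_pos l with rfl | hl0
        · simp
        rw [ih, mul_zero]
        · have : (1 : ℚ) ≤ l := by exact_mod_cast hl0
          push_cast at hN ⊢
          linarith
        · intro n hn
          refine hd (l + n) ?_
          push_cast at hn ⊢
          linarith
  obtain ⟨N, hN⟩ := exists_nat_gt d
  exact key N m d (by have : (0 : ℚ) ≤ m := m.cast_nonneg
                      linarith) hd

end IsUniformizer

end MirTransform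

/-! ### Separating exp(-n f*) from the contribution of the β_k in the integrand. -/

namespace MirTransform

/-! ### The exponential series -/

/-- The coefficient of `w ^ s` in `exp (-B)`, for a series `B` in `w` without constant term. -/
noncomputable def expNegCoeff {A : Type*} [CommRing A] [Algebra ℂ A] (B : PowerSeries A) (s : ℕ) :
    A :=
  ∑ l ∈ Finset.range (s + 1), ((-1 : ℂ) ^ l / (l.factorial : ℂ)) • PowerSeries.coeff s (B ^ l)

theorem coeff_pow_eq_zero' {A : Type*} [CommRing A] {B : PowerSeries A}
    (hB : PowerSeries.constantCoeff B = 0) {n j : ℕ} (h : n < j) :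
    PowerSeries.coeff n (B ^ j) = 0 :=
  PowerSeries.X_pow_dvd_iff.1 (pow_dvd_pow_of_dvd (PowerSeries.X_dvd_iff.2 hB) j) n h

/-- The series `∑_{k ≥ 1} b_k w ^ k`. -/
noncomputable def tailSeries {A : Type*} [CommRing A] (b : ℕ+ → A) : PowerSeries A :=
  PowerSeries.mk fun k => Nat.casesOn k 0 fun k => b k.succPNat

theorem constantCoeff_tailSeries {A : Type*} [CommRing A] (b : ℕ+ → A) :
    PowerSeries.constantCoeff (tailSeries b) = 0 := by
  rw [← PowerSeries.coeff_zero_eq_constantCoeff_apply, tailSeries, PowerSeries.coeff_mk]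
  rfl

theorem coeff_tailSeries_succ {A : Type*} [CommRing A] (b : ℕ+ → A) (k : ℕ) :
    PowerSeries.coeff (k + 1) (tailSeries b) = b k.succPNat := by
  rw [tailSeries, PowerSeries.coeff_mk]

theorem map_tailSeries {A A' : Type*} [CommRing A] [CommRing A'] (F : A →+* A') (b : ℕ+ → A) :
    PowerSeries.map F (tailSeries b) = tailSeries fun k => F (b k) := by
  ext k
  rcases k with _ | k
  · simp [constantCoeff_tailSeries]
  · rw [PowerSeries.coeff_map, coeff_tailSeries_succ, coeff_tailSeries_succ]

theorem sum_range_sum_antidiagonal {M : Type*} [AddCommMonoid M] {N : ℕ} (F : ℕ → ℕ → M)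
    (hF : ∀ i l, N ≤ i + l → F i l = 0) :
    ∑ j ∈ Finset.range N, ∑ m ∈ Finset.HasAntidiagonal.antidiagonal j, F m.1 m.2 =
      ∑ i ∈ Finset.range N, ∑ l ∈ Finset.range N, F i l := by
  rw [← Finset.sum_product', Finset.sum_sigma']
  refine Finset.sum_of_injOn (fun x => x.2) ?_ ?_ ?_ ?_
  · rintro ⟨j, m⟩ hm ⟨j', m'⟩ hm' h
    simp only [Finset.coe_sigma, Set.mem_sigma_iff, Finset.mem_coe,
      Finset.HasAntidiagonal.mem_antidiagonal] at hm hm'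
    dsimp only at h
    obtain ⟨-, rfl⟩ := hm
    obtain ⟨-, rfl⟩ := hm'
    subst h
    rfl
  · rintro ⟨j, m⟩ hm
    simp only [Finset.coe_sigma, Set.mem_sigma_iff, Finset.mem_coe, Finset.mem_range,
      Finset.HasAntidiagonal.mem_antidiagonal, Finset.mem_product] at hm ⊢
    omega
  · rintro ⟨i, l⟩ - h
    refine hF i l (not_lt.1 fun hlt => h ?_)
    refine ⟨⟨i + l, (i, l)⟩, ?_, rfl⟩
    simp only [Finset.coe_sigma, Set.mem_sigma_iff, Finset.mem_coe, Finset.mem_range,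
      Finset.HasAntidiagonal.mem_antidiagonal]
    exact ⟨hlt, trivial⟩
  · rintro ⟨j, m⟩ -
    rfl

/-- Multiplicativity of the exponential, by the binomial theorem. Without constant terms the indices
with i + l > K contribute nothing, so the triangle may be completed to a square. -/
theorem coeff_expNeg_add {A₀ A₁ : PowerSeries ℂ[X]} (h₀ : PowerSeries.constantCoeff A₀ = 0)
    (h₁ : PowerSeries.constantCoeff A₁ = 0) (K : ℕ) :
    PowerSeries.coeff K (expNeg (A₀ + A₁)) =
      ∑ i ∈ Finset.range (K + 1), ∑ l ∈ Finset.range (K + 1),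
        Polynomial.C ((-1 : ℂ) ^ i / (i.factorial : ℂ) * ((-1 : ℂ) ^ l / (l.factorial : ℂ))) *
          PowerSeries.coeff K (A₀ ^ i * A₁ ^ l) := by
  rw [← sum_range_sum_antidiagonal (N := K + 1) (fun i l =>
    Polynomial.C ((-1 : ℂ) ^ i / (i.factorial : ℂ) * ((-1 : ℂ) ^ l / (l.factorial : ℂ))) *
          PowerSeries.coeff K (A₀ ^ i * A₁ ^ l)), expNeg, PowerSeries.coeff_mk]
  · refine Finset.sum_congr rfl fun j _ => ?_
    rw [(Commute.all A₀ A₁).add_pow', map_sum, Finset.mul_sum]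
    refine Finset.sum_congr rfl fun m hm => ?_
    rw [Finset.HasAntidiagonal.mem_antidiagonal] at hm
    rw [map_nsmul, nsmul_eq_mul, ← Polynomial.C_eq_natCast, ← mul_assoc, ← Polynomial.C_mul]
    congr 2
    have h1 : (m.1.factorial : ℂ) ≠ 0 := by exact_mod_cast m.1.factorial_ne_zero
    have h2 : (m.2.factorial : ℂ) ≠ 0 := by exact_mod_cast m.2.factorial_ne_zero
    have h3 : (j.factorial : ℂ) ≠ 0 := by exact_mod_cast j.factorial_ne_zero
    have h4 : (j.choose m.1 : ℂ) * m.1.factorial * m.2.factorial = j.factorial := by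
      subst hm
      rw [Nat.choose_symm_add]
      exact_mod_cast Nat.add_choose_mul_factorial_mul_factorial m.1 m.2
    rw [← hm, _root_.pow_add, hm, ← h4]
    rw [← h4] at h3
    have h5 : (j.choose m.1 : ℂ) ≠ 0 := fun h => by simp [h] at h3
    field_simp
  · intro i l hil
    have h : PowerSeries.X ^ (i + l) ∣ A₀ ^ i * A₁ ^ l := by
      rw [_root_.pow_add]
      exact mul_dvd_mul (pow_dvd_pow_of_dvd (PowerSeries.X_dvd_iff.2 h₀) i)
        (pow_dvd_pow_of_dvd (PowerSeries.X_dvd_iff.2 h₁) l)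
    rw [PowerSeries.X_pow_dvd_iff.1 h K (by omega), mul_zero]

/-! ### Substitution of `τ z` -/

/-- The series `∑_s e_s(τ z) z ^ s` attached to `∑_s e_s(x) w ^ s`. -/
noncomputable def dilate (B : PowerSeries (PowerSeries ℂ)) : PowerSeries ℂ[X] :=
  PowerSeries.mk fun K => ∑ p ∈ Finset.range (K + 1),
    Polynomial.C (PowerSeries.coeff p (PowerSeries.coeff (K - p) B)) * Polynomial.X ^ p

theorem coeff_coeff_dilate (B : PowerSeries (PowerSeries ℂ)) (K p : ℕ) :
    (PowerSeries.coeff K (dilate B)).coeff p =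
      if p ≤ K then PowerSeries.coeff p (PowerSeries.coeff (K - p) B) else 0 := by
  rw [dilate, PowerSeries.coeff_mk, Polynomial.finsetSum_coeff]
  simp only [Polynomial.coeff_C_mul_X_pow]
  rw [Finset.sum_ite_eq]
  simp

theorem sum_antidiagonal_shift {M : Type*} [AddCommMonoid M] (F : ℕ → ℕ → M) (K p q : ℕ) :
    (∑ k ∈ Finset.HasAntidiagonal.antidiagonal K,
      if p ≤ k.1 ∧ q ≤ k.2 then F (k.1 - p) (k.2 - q) else 0) =
    if p + q ≤ K then
      ∑ s ∈ Finset.HasAntidiagonal.antidiagonal (K - (p + q)), F s.1 s.2 else 0 := by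
  split_ifs with h
  · rw [← Finset.sum_filter]
    refine Finset.sum_nbij' (fun k => (k.1 - p, k.2 - q)) (fun s => (s.1 + p, s.2 + q)) ?_ ?_ ?_ ?_
      ?_
    all_goals
      rintro ⟨i, j⟩ hij
      simp only [Finset.mem_filter, Finset.HasAntidiagonal.mem_antidiagonal, Prod.mk.injEq] at hij ⊢
      try omega
  · refine Finset.sum_eq_zero fun k hk => if_neg ?_
    rw [Finset.HasAntidiagonal.mem_antidiagonal] at hk
    omega

/-- The substitution sends x^p w^s to τ^p z^(p+s), which is multiplicative on monomials. -/
theorem dilate_mul (B B' : PowerSeries (PowerSeries ℂ)) :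
    dilate (B * B') = dilate B * dilate B' := by
  ext K p
  rw [coeff_coeff_dilate, PowerSeries.coeff_mul, PowerSeries.coeff_mul, Polynomial.finsetSum_coeff]
  simp only [Polynomial.coeff_mul, coeff_coeff_dilate, map_sum, PowerSeries.coeff_mul]
  have : ∀ x ∈ Finset.HasAntidiagonal.antidiagonal p,
      (∑ k ∈ Finset.HasAntidiagonal.antidiagonal K,
        (if x.1 ≤ k.1 then PowerSeries.coeff x.1 (PowerSeries.coeff (k.1 - x.1) B) else 0) *
        (if x.2 ≤ k.2 then PowerSeries.coeff x.2 (PowerSeries.coeff (k.2 - x.2) B') else 0)) =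
      if p ≤ K then ∑ s ∈ Finset.HasAntidiagonal.antidiagonal (K - p),
        PowerSeries.coeff x.1 (PowerSeries.coeff s.1 B) *
          PowerSeries.coeff x.2 (PowerSeries.coeff s.2 B') else 0 := by
    intro x hx
    have h := sum_antidiagonal_shift (fun i j => PowerSeries.coeff x.1 (PowerSeries.coeff i B) *
      PowerSeries.coeff x.2 (PowerSeries.coeff j B')) K x.1 x.2
    rw [Finset.HasAntidiagonal.mem_antidiagonal.1 hx] at h
    rw [← h]
    refine Finset.sum_congr rfl fun k _ => ?_
    by_cases h1 : x.1 ≤ k.1 <;> by_cases h2 : x.2 ≤ k.2 <;> simp [h1, h2]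
  symm
  rw [Finset.sum_comm, Finset.sum_congr rfl this]
  split_ifs
  · rw [Finset.sum_comm]
  · simp

theorem dilate_one : dilate 1 = 1 := by
  ext K p
  rw [coeff_coeff_dilate, PowerSeries.coeff_one, PowerSeries.coeff_one]
  rcases Nat.eq_zero_or_pos K with rfl | hK
  · rcases Nat.eq_zero_or_pos p with rfl | hp
    · simp
    · rw [if_neg (by omega), if_pos rfl, Polynomial.coeff_one, if_neg hp.ne']
  · rw [if_neg hK.ne', Polynomial.coeff_zero]
    split_ifs with h1 h2
    · rw [PowerSeries.coeff_one, if_neg (by omega)]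
    · simp
    · rfl

theorem dilate_pow (B : PowerSeries (PowerSeries ℂ)) (n : ℕ) : dilate (B ^ n) = dilate B ^ n := by
  induction n with
  | zero => rw [pow_zero, pow_zero, dilate_one]
  | succ n ih => rw [pow_succ, pow_succ, dilate_mul, ih]

/-! ### The coefficients of `exp_#(-f^{↑β*})` -/

/-- The series `∑_{k ≥ 1} β_k f^{(k)}(x) w ^ k`. -/
noncomputable def jetSeries (β : ℕ+ → ℂ) (f : PowerSeries ℂ) : PowerSeries (PowerSeries ℂ) :=
  tailSeries fun k => β k • (PowerSeries.derivative ℂ)^[k] f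

/-- The integral `∫_0 f` without its leading term. -/
noncomputable def primTail (κ : ℕ) (f : PowerSeries ℂ) : PowerSeries ℂ :=
  PowerSeries.C (primLead κ f) * (PowerSeries.X ^ (κ + 1) * relTail κ f)

theorem coeff_primTail_succ {κ : ℕ} {f : PowerSeries ℂ} (h : ∀ k < κ, PowerSeries.coeff k f = 0)
    (hf : PowerSeries.coeff κ f ≠ 0) (K : ℕ) :
    PowerSeries.coeff (K + 1) (primTail κ f) =
      PowerSeries.coeff K f / ((K : ℂ) + 1) - if K = κ then primLead κ f else 0 := by
  have h1 := congrArg (PowerSeries.coeff (K + 1)) (primitive_eq h hf)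
  rw [primitive, PowerSeries.coeff_mk, if_neg K.succ_ne_zero, Nat.add_sub_cancel, mul_add, mul_one,
    mul_add, map_add, PowerSeries.coeff_C_mul, PowerSeries.coeff_X_pow] at h1
  rw [primTail]
  push_cast at h1
  rw [h1]
  split_ifs <;> simp

/-- The tail of f* starts at x^(κ+2). Since κ + 2 ≥ 2, this beats the factor n^i accompanying its
i-th power, and is the source of all the finiteness below. -/
theorem coeff_primTail_pow_mul (κ : ℕ) (f φ : PowerSeries ℂ) {i p : ℕ} (h : p < (κ + 2) * i) :
    PowerSeries.coeff p (primTail κ f ^ i * φ) = 0 := by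
  have h1 : PowerSeries.X ^ (κ + 2) ∣ primTail κ f := by
    rw [primTail, pow_succ]
    exact Dvd.dvd.mul_left (mul_dvd_mul_left _
      (PowerSeries.X_dvd_iff.2 (constantCoeff_relTail κ f))) _
  refine PowerSeries.X_pow_dvd_iff.1 (Dvd.dvd.mul_right ?_ φ) p h
  rw [pow_mul]
  exact pow_dvd_pow_of_dvd h1 i

theorem coeff_iterate_derivative_eq (f : PowerSeries ℂ) {s k : ℕ} (h : s ≤ k) :
    PowerSeries.coeff (k - s) ((PowerSeries.derivative ℂ)^[s] f) =
      (k.descFactorial s : ℂ) * PowerSeries.coeff k f := by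
  obtain ⟨m, rfl⟩ := Nat.exists_eq_add_of_le' h
  rw [Nat.add_sub_cancel, PowerSeries.coeff_iterate_derivative,
    Nat.add_descFactorial_eq_ascFactorial]

theorem coeff_dilate_jetSeries (β : ℕ+ → ℂ) (f : PowerSeries ℂ) (K : ℕ) :
    PowerSeries.coeff K (dilate (jetSeries β f)) =
      Polynomial.C (PowerSeries.coeff K f) * ∑ s ∈ Finset.range K,
      Polynomial.C (β s.succPNat * (K.descFactorial (s + 1) : ℂ)) *
        Polynomial.X ^ (K - (s + 1)) := by
  rw [dilate, PowerSeries.coeff_mk, Finset.sum_range_succ, Nat.sub_self, jetSeries,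
    PowerSeries.coeff_zero_eq_constantCoeff_apply, constantCoeff_tailSeries, map_zero, map_zero,
    zero_mul, add_zero, Finset.mul_sum, ← Finset.sum_range_reflect]
  refine Finset.sum_congr rfl fun s hs => ?_
  rw [Finset.mem_range] at hs
  rw [show K - (K - 1 - s) = s + 1 by omega, coeff_tailSeries_succ,
    show K - 1 - s = K - (s + 1) by omega, PowerSeries.coeff_smul, Nat.succPNat_coe,
    coeff_iterate_derivative_eq f (by omega), ← mul_assoc, ← Polynomial.C_mul]
  congr 2
  rw [smul_eq_mul]
  ring

/-- The term τ⁻¹ of β contributes z⁻¹ f*(τz) and the other terms the jets of f; multiplying by the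
power series variable z clears z⁻¹. -/
theorem X_mul_upArrow_sub {κ : ℕ} {f : PowerSeries ℂ} (h : ∀ k < κ, PowerSeries.coeff k f = 0)
    (hf : PowerSeries.coeff κ f ≠ 0) (β : ℕ+ → ℂ) :
    PowerSeries.X * (upArrow β κ f - dilate (jetSeries β f)) =
      dilate (PowerSeries.C (primTail κ f)) := by
  ext K p
  rw [coeff_coeff_dilate, PowerSeries.coeff_C]
  rcases K with _ | K
  · rw [PowerSeries.coeff_zero_X_mul, Polynomial.coeff_zero, Nat.zero_sub, if_pos rfl]
    split_ifs with h0
    · obtain rfl : p = 0 := by omega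
      have := coeff_primTail_pow_mul κ f 1 (i := 1) (p := 0) (by omega)
      rw [pow_one, mul_one] at this
      exact this.symm
    · rfl
  rw [PowerSeries.coeff_succ_X_mul, map_sub, coeff_dilate_jetSeries, upArrow, PowerSeries.coeff_mk,
    betaPoly]
  have h1 : (if κ ≤ K then Polynomial.C (PowerSeries.coeff K f) *
      (Polynomial.C (1 / ((K : ℂ) + 1)) * Polynomial.X ^ (K + 1) + ∑ s ∈ Finset.range K,
      Polynomial.C (β s.succPNat * (K.descFactorial (s + 1) : ℂ)) *
        Polynomial.X ^ (K - (s + 1))) else 0) = Polynomial.C (PowerSeries.coeff K f) *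
      (Polynomial.C (1 / ((K : ℂ) + 1)) * Polynomial.X ^ (K + 1) + ∑ s ∈ Finset.range K,
      Polynomial.C (β s.succPNat * (K.descFactorial (s + 1) : ℂ)) *
        Polynomial.X ^ (K - (s + 1))) := by
    split_ifs with hK
    · rfl
    · rw [h K (by omega)]; simp
  rw [h1, mul_add, add_sub_right_comm, add_sub_cancel_right, ← mul_assoc, ← Polynomial.C_mul,
    Polynomial.coeff_sub, Polynomial.coeff_C_mul_X_pow]
  have h2 := coeff_primTail_succ h hf K
  by_cases hp : p = K + 1
  · subst hp
    rw [if_pos rfl, if_pos le_rfl, Nat.sub_self, if_pos rfl, h2, primLead]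
    split_ifs with hK
    · subst hK; rw [Polynomial.coeff_C_mul_X_pow, if_pos rfl, mul_one_div]
    · simp [div_eq_mul_inv]
  · rw [if_neg hp]
    have h3 : (if K = κ then Polynomial.C (PowerSeries.coeff κ f / ((κ : ℂ) + 1)) *
        Polynomial.X ^ (κ + 1) else 0 : ℂ[X]).coeff p = 0 := by
      split_ifs with hK
      · subst hK; rw [Polynomial.coeff_C_mul_X_pow, if_neg hp]
      · simp
    rw [h3]
    split_ifs with h4 h5
    · omega
    · simp
    · simp

/-- The i factors z⁻¹ raise the order from K to K + i; removing x^p leaves w^(K+i-p) for the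
exponential of the jets. Any M > K is allowed, since for i > K and p ≤ K + i one has p < (κ+2) i; so
one M can serve for all K in a finite range. -/
theorem nirCoeff_eq {κ : ℕ} {f : PowerSeries ℂ} (h : ∀ k < κ, PowerSeries.coeff k f = 0)
    (hf : PowerSeries.coeff κ f ≠ 0) (β : ℕ+ → ℂ) {K M : ℕ} (hM : K < M) (p : ℕ) :
    nirCoeff β κ f K p = ∑ i ∈ Finset.range M, if p ≤ K + i then
      (-1 : ℂ) ^ i / (i.factorial : ℂ) *
        PowerSeries.coeff p (primTail κ f ^ i * expNegCoeff (jetSeries β f) (K + i - p)) else 0 := by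
  set A₁ := dilate (jetSeries β f) with hA₁
  set A₀ := upArrow β κ f - A₁ with hA₀
  have hB : PowerSeries.constantCoeff (jetSeries β f) = 0 := constantCoeff_tailSeries _
  have hX := X_mul_upArrow_sub h hf β
  rw [← hA₁, ← hA₀] at hX
  have h₁ : PowerSeries.constantCoeff A₁ = 0 := by
    rw [← PowerSeries.coeff_zero_eq_constantCoeff_apply, coeff_dilate_jetSeries]
    simp
  have h₀ : PowerSeries.constantCoeff A₀ = 0 := by
    rw [← PowerSeries.coeff_zero_eq_constantCoeff_apply, ← PowerSeries.coeff_succ_X_mul, hX]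
    ext p
    rw [coeff_coeff_dilate, PowerSeries.coeff_C, Polynomial.coeff_zero]
    split_ifs with h1 h2
    · have := coeff_primTail_pow_mul κ f 1 (i := 1) (p := p) (by omega)
      rwa [pow_one, mul_one] at this
    · simp
    · rfl
  have hterm : ∀ i l, (PowerSeries.coeff K (A₀ ^ i * A₁ ^ l)).coeff p =
      if p ≤ K + i then PowerSeries.coeff p
        (primTail κ f ^ i * PowerSeries.coeff (K + i - p) (jetSeries β f ^ l)) else 0 := by
    intro i l
    have h2 : PowerSeries.X ^ i * (A₀ ^ i * A₁ ^ l) =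
        dilate (PowerSeries.C (primTail κ f ^ i) * jetSeries β f ^ l) := by
      rw [dilate_mul, dilate_pow, map_pow, dilate_pow, ← hX, ← hA₁, mul_pow,
        mul_assoc]
    rw [← PowerSeries.coeff_X_pow_mul _ i K, h2, coeff_coeff_dilate, PowerSeries.coeff_C_mul]
  rw [nirCoeff, show upArrow β κ f = A₀ + A₁ by rw [hA₀, sub_add_cancel], coeff_expNeg_add h₀ h₁,
    Polynomial.finsetSum_coeff]
  have hvan : ∀ i ∈ Finset.range M, i ∉ Finset.range (K + 1) → (if p ≤ K + i then
      (-1 : ℂ) ^ i / (i.factorial : ℂ) *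
        PowerSeries.coeff p (primTail κ f ^ i * expNegCoeff (jetSeries β f) (K + i - p))
        else 0) = 0 := by
    intro i _ hi
    rw [Finset.mem_range, not_lt] at hi
    split_ifs with h1
    · rw [coeff_primTail_pow_mul, mul_zero]
      nlinarith
    · rfl
  rw [← Finset.sum_subset (Finset.range_mono hM) hvan]
  refine Finset.sum_congr rfl fun i hi => ?_
  rw [Polynomial.finsetSum_coeff]
  simp only [Polynomial.coeff_C_mul, hterm]
  by_cases h1 : p ≤ K + i
  swap
  · simp [h1]
  simp only [if_pos h1]
  by_cases h2 : p < (κ + 2) * i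
  · rw [coeff_primTail_pow_mul _ _ _ h2, mul_zero]
    exact Finset.sum_eq_zero fun l _ => by rw [coeff_primTail_pow_mul _ _ _ h2, mul_zero]
  -- This gives K + i - p ≤ K, so the range of `l` in `expNegCoeff` lies inside that of the double
  -- sum.
  have h3 : i ≤ p := by nlinarith
  rw [expNegCoeff, Finset.mul_sum, map_sum, Finset.mul_sum]
  symm
  refine (Finset.sum_subset (Finset.range_mono (by omega)) fun l _ hl => ?_).trans
    (Finset.sum_congr rfl fun l _ => ?_)
  · rw [coeff_pow_eq_zero' hB (by rw [Finset.mem_range, not_lt] at hl; omega)]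
    simp
  · rw [mul_smul_comm, PowerSeries.coeff_smul, smul_eq_mul]
    ring

end MirTransform

/-! ### The formal change of variables y = f*(x) under the Laplace and Borel integrals. -/

namespace MirTransform

open HahnSeries

/-! ### Iterated integration and the Gamma function -/

theorem Gamma_add_natCast {x : ℝ} (hx : 0 < x) (j : ℕ) :
    Real.Gamma (x + j) = Real.Gamma x * ∏ i ∈ Finset.range j, (x + i) := by
  induction j with
  | zero => simp
  | succ j ih =>
    rw [Finset.prod_range_succ, ← mul_assoc, ← ih, Nat.cast_succ, ← add_assoc,
      Real.Gamma_add_one (by positivity), mul_comm]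

/-- On the Borel side n^(-q) is y^q / Γ(q+1); there ∂^(-s) is multiplication by n^(-s). -/
theorem coeff_integ_iterate {φ : HahnSeries ℚ ℂ} (hφ : IsIntegrableAtZero φ) (s : ℕ) (q : ℚ) :
    (integ^[s] φ).coeff q = φ.coeff (q - s) *
      ((Real.Gamma ((q : ℝ) - s + 1) : ℝ) : ℂ) / ((Real.Gamma ((q : ℝ) + 1) : ℝ) : ℂ) := by
  induction s generalizing q with
  | zero =>
    -- Gamma takes the value 0 at its poles, so it cannot be cancelled there; integrability makes
    -- the coefficient vanish for q ≤ -1.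
    by_cases h0 : φ.coeff q = 0
    · simp [h0]
    · have hq : -1 < q := not_le.1 fun h => h0 (hφ q h)
      have hq' : (0 : ℝ) < (q : ℝ) + 1 := by
        have : ((-1 : ℚ) : ℝ) < q := by exact_mod_cast hq
        push_cast at this; linarith
      have : ((Real.Gamma ((q : ℝ) + 1) : ℝ) : ℂ) ≠ 0 := by
        exact_mod_cast (Real.Gamma_pos_of_pos hq').ne'
      simp [this]
  | succ s ih =>
    rw [Function.iterate_succ_apply', coeff_integ, ih]
    have e1 : q - 1 - (s : ℚ) = q - (s + 1 : ℕ) := by push_cast; ring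
    rw [e1]
    by_cases h0 : φ.coeff (q - (s + 1 : ℕ)) = 0
    · simp only [h0, zero_mul, zero_div]
    · have hq : -1 < q - (s + 1 : ℕ) := not_le.1 fun h => h0 (hφ _ h)
      have hq1 : 0 < q := by
        push_cast at hq
        have : (0 : ℚ) ≤ s := s.cast_nonneg
        linarith
      have hq' : (0 : ℝ) < q := by exact_mod_cast hq1
      have hq2 : (q : ℂ) ≠ 0 := by exact_mod_cast hq1.ne'
      have h3 : ((Real.Gamma q : ℝ) : ℂ) ≠ 0 := by
        exact_mod_cast (Real.Gamma_pos_of_pos hq').ne'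
      rw [Real.Gamma_add_one hq'.ne']
      push_cast
      rw [sub_add_cancel, show (q : ℝ) - 1 - s + 1 = q - (s + 1) + 1 by ring]
      field_simp

/-! ### The expansion of `nir` -/

theorem sum_range_shift {M : Type*} [AddCommMonoid M] {g : ℕ → M} {N : ℕ}
    (hg : ∀ s, N ≤ s → g s = 0) {c L : ℕ} (h : c + N ≤ L) :
    (∑ K ∈ Finset.range L, if c ≤ K then g (K - c) else 0) = ∑ s ∈ Finset.range N, g s := by
  obtain ⟨r, rfl⟩ := Nat.exists_eq_add_of_le h
  rw [add_assoc, Finset.sum_range_add, Finset.sum_eq_zero, zero_add]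
  · simp only [Nat.le_add_right, if_true, Nat.add_sub_cancel_left]
    rw [Finset.sum_range_add, Finset.sum_eq_zero fun s _ => hg (N + s) (Nat.le_add_right _ _),
      add_zero]
  · intro K hK
    rw [if_neg (by simpa using hK)]

/-- The contribution to the coefficient of `ν ^ q` in `nir(f)` of the index `j` in the exponential
of the integral of `f`, of the order `s` in the remaining exponential, and of the power `p` of
`τ`. -/
noncomputable def nirSummand (β : ℕ+ → ℂ) (κ : ℕ) (f : PowerSeries ℂ) (ρ : ℂ) (q : ℚ)
    (s j p : ℕ) : ℂ :=
  if (p : ℚ) + 1 = (κ + 1) * (q - s + 1 + j) then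
    (-1 : ℂ) ^ j / (j.factorial : ℂ) *
      PowerSeries.coeff p (primTail κ f ^ j * expNegCoeff (jetSeries β f) s) *
      laplaceFactor κ ρ p / ((Real.Gamma ((q : ℝ) + 1) : ℝ) : ℂ)
  else 0

theorem nirSummand_ne_zero {β : ℕ+ → ℂ} {κ : ℕ} {f : PowerSeries ℂ} {ρ : ℂ} {q : ℚ} {s j p : ℕ}
    (h : nirSummand β κ f ρ q s j p ≠ 0) :
    (κ + 2) * j ≤ p ∧ (p : ℚ) + 1 = (κ + 1) * (q - s + 1 + j) := by
  unfold nirSummand at h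
  split_ifs at h with h1
  · refine ⟨not_lt.1 fun h2 => h ?_, h1⟩
    rw [coeff_primTail_pow_mul _ _ _ h2]
    simp
  · exact absurd rfl h

/-- Inserting p ≥ (κ+2) j into the equation for p gives j + 1 + (κ+1) s ≤ (κ+1)(q+1). -/
theorem nirSummand_bounds {β : ℕ+ → ℂ} {κ : ℕ} {f : PowerSeries ℂ} {ρ : ℂ} {q : ℚ} {s j p N : ℕ}
    (hN : ((κ : ℚ) + 1) * (q + 1) ≤ N) (h : nirSummand β κ f ρ q s j p ≠ 0) :
    j ≤ p ∧ s < N ∧ j < N := by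
  obtain ⟨h1, h2⟩ := nirSummand_ne_zero h
  have h3 : ((κ : ℚ) + 2) * j ≤ p := by exact_mod_cast h1
  have h4 : (j : ℚ) + 1 + (κ + 1) * s ≤ N := by nlinarith
  have h5 : j + 1 + (κ + 1) * s ≤ N := by exact_mod_cast h4
  refine ⟨by nlinarith, by nlinarith, by nlinarith⟩

theorem coeff_nir_eq_sum {κ : ℕ} {f : PowerSeries ℂ} (h : ∀ k < κ, PowerSeries.coeff k f = 0)
    (hf : PowerSeries.coeff κ f ≠ 0) (β : ℕ+ → ℂ) (ρ : ℂ) {q : ℚ} {N : ℕ}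
    (hN : ((κ : ℚ) + 1) * (q + 1) ≤ N) :
    (nir β κ f ρ).coeff q = ∑ s ∈ Finset.range N, ∑ j ∈ Finset.range N,
      ∑ p ∈ Finset.range (2 * (κ + 2) * N), nirSummand β κ f ρ q s j p := by
  -- Nonzero terms have K < (κ+1)N and p ≤ 2K, hence p < P. Summing K up to P + N leaves room for
  -- the shift K = s + (p - j) with s < N.
  set P := 2 * (κ + 2) * N with hP
  have hbox : (nir β κ f ρ).coeff q = ∑ K ∈ Finset.range (P + N), ∑ p ∈ Finset.range P,
      (nirTerm β κ f ρ K p).coeff q := by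
    rw [nir, SummableFamily.coeff_hsum, ← Finset.sum_product']
    refine finsum_eq_sum_of_support_subset _ ?_
    rintro ⟨K, p⟩ hKp
    obtain ⟨h1, h2⟩ := nirTerm_coeff_ne_zero hKp
    have h4 : ((κ : ℚ) + 1) * p ≤ ((κ : ℚ) + 2) * K := by exact_mod_cast h2
    have hk : (0 : ℚ) ≤ κ := Nat.cast_nonneg κ
    have h5 : (q + 1) * ((κ : ℚ) + 1) ^ 2 =
        ((κ : ℚ) + 1) ^ 2 * K - κ * ((κ + 1) * p) + (κ + 1) := by
      rw [h1, nirExp]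
      field_simp
      ring
    have h6 : (K : ℚ) < (κ + 1) * N := by
      have := mul_le_mul_of_nonneg_left h4 hk
      nlinarith
    have h7 : K < (κ + 1) * N := by exact_mod_cast h6
    have hp : p ≤ 2 * K := by
      have h7 : (κ + 1) * p ≤ (κ + 1) * (2 * K) := by nlinarith
      exact Nat.le_of_mul_le_mul_left h7 (Nat.succ_pos κ)
    simp only [Finset.coe_product, Finset.coe_range, Set.mem_prod, Set.mem_Iio]
    constructor <;> nlinarith
  have hterm : ∀ K ∈ Finset.range (P + N), ∀ p ∈ Finset.range P,
      (nirTerm β κ f ρ K p).coeff q = ∑ j ∈ Finset.range (P + N),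
        if p ≤ K + j then nirSummand β κ f ρ q (K + j - p) j p else 0 := by
    intro K hK p _
    rw [nirTerm, coeff_single]
    have hiff : ∀ j, p ≤ K + j → (q = nirExp κ K p ↔
        (p : ℚ) + 1 = (κ + 1) * (q - (K + j - p : ℕ) + 1 + j)) := by
      intro j hj
      rw [Nat.cast_sub hj, nirExp]
      push_cast
      constructor
      · intro hq
        rw [hq]
        field_simp
        ring
      · intro hq
        field_simp
        linarith
    split_ifs with hq
    · rw [nirCoeff_eq h hf β (Finset.mem_range.1 hK), Finset.sum_mul, Finset.sum_div]
      refine Finset.sum_congr rfl fun j _ => ?_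
      split_ifs with hj
      · rw [nirSummand, if_pos ((hiff j hj).1 hq), ← hq]
      · simp
    · refine (Finset.sum_eq_zero fun j _ => ?_).symm
      split_ifs with hj
      · rw [nirSummand, if_neg (fun h' => hq ((hiff j hj).2 h'))]
      · rfl
  rw [hbox, Finset.sum_congr rfl fun K hK => Finset.sum_congr rfl (hterm K hK), Finset.sum_comm]
  have hinner : ∀ p ∈ Finset.range P, (∑ K ∈ Finset.range (P + N), ∑ j ∈ Finset.range (P + N),
      if p ≤ K + j then nirSummand β κ f ρ q (K + j - p) j p else 0) =
      ∑ j ∈ Finset.range N, ∑ s ∈ Finset.range N, nirSummand β κ f ρ q s j p := by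
    intro p hp
    rw [Finset.mem_range] at hp
    rw [Finset.sum_comm]
    refine (Finset.sum_subset (Finset.range_mono (Nat.le_add_left N P)) fun j _ hj => ?_).symm.trans
      (Finset.sum_congr rfl fun j _ => ?_)
    · refine Finset.sum_eq_zero fun K _ => ?_
      split_ifs
      · by_contra h0
        exact hj (Finset.mem_range.2 (nirSummand_bounds hN h0).2.2)
      · rfl
    · by_cases hjp : j ≤ p
      · rw [← sum_range_shift (g := fun s => nirSummand β κ f ρ q s j p) (N := N) (c := p - j)
          (L := P + N)]
        · refine Finset.sum_congr rfl fun K _ => ?_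
          rw [show K + j - p = K - (p - j) by omega]
          exact if_congr tsub_le_iff_right.symm rfl rfl
        · intro s hs
          by_contra h0
          exact absurd (nirSummand_bounds hN h0).2.1 (by omega)
        · omega
      · have h0 : ∀ s, nirSummand β κ f ρ q s j p = 0 := fun s => by
          by_contra h0
          exact hjp (nirSummand_bounds hN h0).1
        simp [h0]
  rw [Finset.sum_congr rfl hinner, Finset.sum_comm]
  rw [Finset.sum_congr rfl fun j _ => Finset.sum_comm, Finset.sum_comm]

theorem laplaceFactor_eq (κ : ℕ) (ρ : ℂ) (p : ℕ) :
    laplaceFactor κ ρ p = rootPow κ ρ (p + 1) *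
      ((Real.Gamma (((p : ℝ) + 1) / ((κ : ℝ) + 1)) : ℝ) : ℂ) := by
  rw [laplaceFactor, rootPow]
  push_cast
  ring

theorem rootPow_add_mul {κ : ℕ} {f : PowerSeries ℂ} {ρ : ℂ}
    (h : ρ ^ (κ + 1) * PowerSeries.coeff κ f = 1) (d j : ℕ) :
    rootPow κ ρ d = primLead κ f ^ j * rootPow κ ρ (d + (κ + 1) * j) := by
  induction j with
  | zero => simp
  | succ j ih =>
    rw [ih, rootPow_add h (d + (κ + 1) * j), pow_succ, mul_add_one, add_assoc]
    ring

theorem coeff_primTail_pow_mul_add (κ : ℕ) (f φ : PowerSeries ℂ) (d j : ℕ) :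
    PowerSeries.coeff (d + (κ + 1) * j) (primTail κ f ^ j * φ) =
      primLead κ f ^ j * PowerSeries.coeff d (relTail κ f ^ j * φ) := by
  rw [primTail, mul_pow, mul_pow, ← pow_mul, ← map_pow, mul_assoc, PowerSeries.coeff_C_mul,
    mul_assoc, PowerSeries.coeff_X_pow_mul]

/-- Matches the j-th binomial term of the Lagrange formula with the j-th term of the exponential
after Laplace integration. -/
theorem negBinom_mul_Gamma {x : ℝ} (hx : 0 < x) (j : ℕ) :
    negBinom x j * ((Real.Gamma x : ℝ) : ℂ) =
      (-1 : ℂ) ^ j / (j.factorial : ℂ) * ((Real.Gamma (x + j) : ℝ) : ℂ) := by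
  rw [Gamma_add_natCast hx, negBinom]
  push_cast
  ring

namespace IsUniformizer

variable {κ : ℕ} {f : PowerSeries ℂ} {ρ : ℂ} {gs : HahnSeries ℚ ℂ}

theorem vanishesBelow_heval_mul_deriv (h : IsUniformizer κ f ρ gs) (φ : PowerSeries ℂ) :
    VanishesBelow (PowerSeries.heval gs φ * deriv gs) (1 / ((κ : ℚ) + 1) - 1) :=
  ((vanishesBelow_heval h.pos φ).mul h.vanishesBelow_deriv).mono (by linarith)

theorem isIntegrableAtZero (h : IsUniformizer κ f ρ gs) (φ : PowerSeries ℂ) :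
    IsIntegrableAtZero (PowerSeries.heval gs φ * deriv gs) :=
  (h.vanishesBelow_heval_mul_deriv φ).isIntegrableAtZero (by
    have : (0 : ℚ) < 1 / ((κ : ℚ) + 1) := by positivity
    linarith)

/-- Lagrange–Bürmann: in `coeff_pow_mul_deriv` the exponent of 1 + u depends only on m + n, so
summing over the coefficients of φ is a Cauchy product. -/
theorem coeff_heval_mul_deriv (h : IsUniformizer κ f ρ gs) (φ : PowerSeries ℂ) (D : ℕ) :
    (PowerSeries.heval gs φ * deriv gs).coeff (((D + 1 : ℕ) : ℚ) / ((κ : ℚ) + 1) - 1) =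
      rootPow κ ρ (D + 1) * PowerSeries.coeff D
        (negPowSum (relTail κ f) (D + 1) (((D + 1 : ℕ) : ℂ) / ((κ : ℂ) + 1)) * φ) := by
  have hκ1 : (0 : ℚ) < (κ : ℚ) + 1 := by positivity
  have h1 := h.coeff_heval_mul_pow_mul_deriv φ (m := 0) (N := D + 1)
    (e := ((D + 1 : ℕ) : ℚ) / ((κ : ℚ) + 1) - 1) (by
      rw [sub_lt_sub_iff_right, div_lt_div_iff_of_pos_right hκ1]
      push_cast; linarith)
  rw [pow_zero, one_mul] at h1
  rw [h1, mul_comm _ φ, PowerSeries.coeff_mul,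
    Finset.Nat.sum_antidiagonal_eq_sum_range_succ_mk, Finset.mul_sum]
  refine Finset.sum_congr rfl fun m hm => ?_
  have hmD : m ≤ D := Nat.lt_succ_iff.1 (Finset.mem_range.1 hm)
  have h2 := h.coeff_pow_mul_deriv (D - m) m
  rw [show m + 1 + (D - m) = D + 1 by omega] at h2
  rw [zero_add, h2, coeff_negPowSum (constantCoeff_relTail κ f) (by omega)]
  ring

theorem coeff_heval_mul_deriv_eq_zero (h : IsUniformizer κ f ρ gs) (φ : PowerSeries ℂ) {d : ℚ}
    (hd : ∀ n : ℕ, d ≠ n + 1) :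
    (PowerSeries.heval gs φ * deriv gs).coeff (d / ((κ : ℚ) + 1) - 1) = 0 := by
  have hκ1 : (0 : ℚ) < (κ : ℚ) + 1 := by positivity
  obtain ⟨N, hN⟩ := exists_nat_gt d
  have h1 := h.coeff_heval_mul_pow_mul_deriv φ (m := 0) (N := N)
    (e := d / ((κ : ℚ) + 1) - 1) (by
      rw [sub_lt_sub_iff_right, div_lt_div_iff_of_pos_right hκ1]
      push_cast; linarith)
  rw [pow_zero, one_mul] at h1
  rw [h1]
  refine Finset.sum_eq_zero fun l _ => ?_
  rw [h.coeff_pow_mul_deriv_eq_zero, mul_zero]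
  intro n hn
  refine hd (0 + l + n) ?_
  push_cast at hn ⊢
  linarith

/-- Let δ = q - s + 1 = (D+1)/(κ+1). The left side is, up to common factors, Γ(δ) times the
coefficient of x^D in (1+u)^(-δ) φ. Its j-th binomial term meets the single power p = D + (κ+1) j on
the right, where the Laplace integral supplies Γ(δ+j). If (κ+1)δ is not a positive integer, both
sides vanish. -/
theorem coeff_integ_iterate_heval (h : IsUniformizer κ f ρ gs) (β : ℕ+ → ℂ) {q : ℚ} {N : ℕ}
    (hN : ((κ : ℚ) + 1) * (q + 1) ≤ N) (s : ℕ) :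
    (integ^[s] (PowerSeries.heval gs (expNegCoeff (jetSeries β f) s) * deriv gs)).coeff q =
      ∑ j ∈ Finset.range N, ∑ p ∈ Finset.range (2 * (κ + 2) * N),
        nirSummand β κ f ρ q s j p := by
  have hκ0 : (κ : ℚ) + 1 ≠ 0 := Nat.cast_add_one_ne_zero κ
  have hκ1 : (0 : ℚ) < (κ : ℚ) + 1 := by positivity
  have hκ2 : (0 : ℝ) < (κ : ℝ) + 1 := by positivity
  set φ := expNegCoeff (jetSeries β f) s with hφ
  rw [coeff_integ_iterate (h.isIntegrableAtZero φ)]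
  have e1 : q - s = (((κ : ℚ) + 1) * (q - s + 1)) / ((κ : ℚ) + 1) - 1 := by
    field_simp
    ring
  by_cases hd : ∃ D : ℕ, ((κ : ℚ) + 1) * (q - s + 1) = D + 1
  · obtain ⟨D, hD⟩ := hd
    have hDN : D + 1 ≤ N := by
      have : ((D + 1 : ℕ) : ℚ) ≤ N := by
        push_cast
        rw [← hD]
        have : (0 : ℚ) ≤ s := s.cast_nonneg
        nlinarith
      exact_mod_cast this
    have e2 : q - s = ((D + 1 : ℕ) : ℚ) / ((κ : ℚ) + 1) - 1 := by
      rw [e1, hD]; push_cast; ring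
    have e3 : (q : ℝ) - s + 1 = ((D + 1 : ℕ) : ℝ) / ((κ : ℝ) + 1) := by
      have := congrArg (fun x : ℚ => (x : ℝ)) e2
      push_cast at this ⊢
      linarith
    have hx : (0 : ℝ) < ((D + 1 : ℕ) : ℝ) / ((κ : ℝ) + 1) := by positivity
    rw [e2, h.coeff_heval_mul_deriv, e3, negPowSum, Finset.sum_mul, map_sum, Finset.mul_sum,
      Finset.sum_mul, Finset.sum_div]
    refine (Finset.sum_subset (Finset.range_mono hDN) fun j _ hj => ?_).trans
      (Finset.sum_congr rfl fun j hj => ?_)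
    · rw [Finset.mem_range, not_lt] at hj
      have : PowerSeries.X ^ j ∣ relTail κ f ^ j :=
        pow_dvd_pow_of_dvd (PowerSeries.X_dvd_iff.2 (constantCoeff_relTail κ f)) j
      rw [PowerSeries.X_pow_dvd_iff.1 ((this.mul_left _).mul_right φ) D (by omega)]
      simp
    · rw [Finset.mem_range] at hj
      rw [Finset.sum_eq_single (D + (κ + 1) * j)]
      · have e4 : ((D + (κ + 1) * j : ℕ) : ℚ) + 1 = (κ + 1) * (q - s + 1 + j) := by
          rw [mul_add, hD]; push_cast; ring
        have e5 : (((D + (κ + 1) * j : ℕ) : ℝ) + 1) / ((κ : ℝ) + 1) =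
            ((D + 1 : ℕ) : ℝ) / ((κ : ℝ) + 1) + j := by
          push_cast
          field_simp
          ring
        rw [nirSummand, if_pos e4, coeff_primTail_pow_mul_add, laplaceFactor_eq, e5,
          mul_assoc (PowerSeries.C _), PowerSeries.coeff_C_mul, rootPow_add_mul h.root (D + 1) j,
          show D + 1 + (κ + 1) * j = D + (κ + 1) * j + 1 by ring, ← hφ]
        have h6 := negBinom_mul_Gamma hx j
        push_cast at h6 ⊢
        linear_combination (primLead κ f ^ j * rootPow κ ρ (D + (κ + 1) * j + 1) *
          PowerSeries.coeff D (relTail κ f ^ j * φ) /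
            ((Real.Gamma ((q : ℝ) + 1) : ℝ) : ℂ)) * h6
      · intro p _ hp
        by_contra h0
        refine hp ?_
        have h7 := (nirSummand_ne_zero h0).2
        rw [mul_add, hD] at h7
        have h8 : (p : ℚ) = ((D + (κ + 1) * j : ℕ) : ℚ) := by push_cast; linarith
        exact_mod_cast h8
      · intro hp
        exfalso
        apply hp
        rw [Finset.mem_range]
        nlinarith
  · push Not at hd
    rw [e1, h.coeff_heval_mul_deriv_eq_zero φ hd]
    simp only [zero_mul, zero_div]
    refine (Finset.sum_eq_zero fun j _ => Finset.sum_eq_zero fun p _ => ?_).symm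
    by_contra h0
    obtain ⟨h1, h2⟩ := nirSummand_ne_zero h0
    have h3 : (κ + 1) * j ≤ p := by nlinarith
    refine hd (p - (κ + 1) * j) ?_
    rw [Nat.cast_sub h3]
    push_cast
    linarith

theorem coeff_nir (h : IsUniformizer κ f ρ gs) (β : ℕ+ → ℂ) {q : ℚ} {N : ℕ}
    (hN : ((κ : ℚ) + 1) * (q + 1) ≤ N) :
    (nir β κ f ρ).coeff q = ∑ s ∈ Finset.range N,
      (integ^[s] (PowerSeries.heval gs (expNegCoeff (jetSeries β f) s) * deriv gs)).coeff q := by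
  rw [coeff_nir_eq_sum h.coeff_eq_zero h.coeff_ne_zero β ρ hN]
  exact Finset.sum_congr rfl fun s _ => (h.coeff_integ_iterate_heval β hN s).symm

end IsUniformizer

end MirTransform

/-! ### The universal polynomials Mir: integrality, homogeneity, parity. -/

namespace MirTransform

open MvPolynomial

/-! ### Differential polynomials -/

/-- The weight recording the degree and the differential order of a differential monomial. -/
def jetWeight (i : ℕ) : ℕ × ℕ := (1, i)

theorem weight_jetWeight (n : ℕ →₀ ℕ) : Finsupp.weight jetWeight n = (deg n, order n) := by
  rw [Finsupp.weight_apply, deg, order]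
  ext
  · rw [Finsupp.sum, Prod.fst_sum]
    simp [jetWeight, Finsupp.sum]
  · rw [Finsupp.sum, Prod.snd_sum]
    simp [jetWeight, Finsupp.sum, mul_comm]

theorem mem_multiIndices {n : ℕ →₀ ℕ} {r s : ℕ} :
    n ∈ multiIndices r s ↔ deg n = r ∧ order n = s := by
  rw [multiIndices, Finset.mem_filter, Finset.mem_finsuppAntidiag', deg]
  refine ⟨fun h => ⟨h.1.1, h.2⟩, fun h => ⟨⟨h.1, fun i hi => ?_⟩, h.2⟩⟩
  have h1 : i * n i ≤ s := by
    rw [← h.2, order, Finsupp.sum]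
    exact Finset.single_le_sum (f := fun i => i * n i) (fun _ _ => Nat.zero_le _) hi
  have h2 : 1 ≤ n i := Nat.one_le_iff_ne_zero.2 (Finsupp.mem_support_iff.1 hi)
  rw [Finset.mem_range]
  nlinarith

/-- The derivation of differential polynomials with `∂ X_i = X_{i+1}`. -/
noncomputable def jetDeriv : Derivation ℤ (MvPolynomial ℕ ℤ) (MvPolynomial ℕ ℤ) :=
  mkDerivation ℤ fun i => X (i + 1)

/-- The differential polynomial `(φ ∂) ^ k φ` in `φ`. -/
noncomputable def jetPoly : ℕ → MvPolynomial ℕ ℤ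
  | 0 => X 0
  | k + 1 => X 0 * jetDeriv (jetPoly k)

theorem isWeightedHomogeneous_jetDeriv {P : MvPolynomial ℕ ℤ} {r s : ℕ}
    (h : P.IsWeightedHomogeneous jetWeight (r, s)) :
    (jetDeriv P).IsWeightedHomogeneous jetWeight (r, s + 1) := by
  induction h using IsWeightedHomogeneous.induction_on with
  | zero => rw [map_zero]; exact isWeightedHomogeneous_zero _ _ _
  | add p q _ _ hp hq => rw [map_add]; exact hp.add hq
  | monomial d a hd =>
    rw [jetDeriv, mkDerivation_monomial, smul_eq_C_mul]
    refine IsWeightedHomogeneous.C_mul (IsWeightedHomogeneous.sum _ _ _ fun i hi => ?_) _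
    have h1 : d - Finsupp.single i 1 + Finsupp.single i 1 = d := by
      refine tsub_add_cancel_of_le ?_
      rw [Finsupp.single_le_iff]
      exact Nat.one_le_iff_ne_zero.2 (Finsupp.mem_support_iff.1 hi)
    have h2 : (r, s + 1) =
        Finsupp.weight jetWeight (d - Finsupp.single i 1) + jetWeight (i + 1) := by
      have h3 : Finsupp.weight jetWeight (d - Finsupp.single i 1) + jetWeight i = (r, s) := by
        rw [← hd]
        conv_rhs => rw [← h1, map_add, Finsupp.weight_single, one_smul]
      have h4 : jetWeight (i + 1) = jetWeight i + (0, 1) := rfl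
      rw [h4, ← add_assoc, h3]
      rfl
    rw [h2]
    exact (isWeightedHomogeneous_monomial _ _ _ rfl).mul (isWeightedHomogeneous_X _ _ _)

theorem isWeightedHomogeneous_jetPoly (k : ℕ) :
    (jetPoly k).IsWeightedHomogeneous jetWeight (k + 1, k) := by
  induction k with
  | zero => exact isWeightedHomogeneous_X _ _ _
  | succ k ih =>
    have h := (isWeightedHomogeneous_X ℤ jetWeight 0).mul (isWeightedHomogeneous_jetDeriv ih)
    have e : jetWeight 0 + (k + 1, k + 1) = (k + 1 + 1, k + 1) := by
      simp only [jetWeight, Prod.mk_add_mk]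
      ring_nf
    rwa [e] at h

theorem eval₂_jetDeriv (φ : HahnSeries ℚ ℂ) (P : MvPolynomial ℕ ℤ) :
    eval₂Hom (Int.castRingHom _) (fun i => deriv^[i] φ) (jetDeriv P) =
      deriv (eval₂Hom (Int.castRingHom _) (fun i => deriv^[i] φ) P) := by
  induction P using MvPolynomial.induction_on with
  | C a =>
    rw [derivation_C, map_zero, eval₂Hom_C, eq_intCast]
    have : ((a : ℤ) : HahnSeries ℚ ℂ) = (a : ℂ) • 1 := by
      rw [← HahnSeries.C_mul_eq_smul, mul_one, map_intCast]
    rw [this, deriv_smul, deriv_one, smul_zero]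
  | add p q hp hq => simp only [map_add, deriv_add, hp, hq]
  | mul_X p i hp =>
    have hX : jetDeriv (X i) = X (i + 1) := mkDerivation_X _ _ _
    rw [Derivation.leibniz, map_add, smul_eq_mul, smul_eq_mul, map_mul, map_mul, map_mul, hX, hp,
      eval₂Hom_X', eval₂Hom_X', deriv_mul, Function.iterate_succ_apply']
    ring

theorem eval₂_jetPoly (φ : HahnSeries ℚ ℂ) (k : ℕ) :
    eval₂Hom (Int.castRingHom _) (fun i => deriv^[i] φ) (jetPoly k) =
      (fun ψ => φ * deriv ψ)^[k] φ := by
  induction k with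
  | zero => rw [jetPoly, eval₂Hom_X']; rfl
  | succ k ih =>
    rw [jetPoly, map_mul, eval₂_jetDeriv, ih, eval₂Hom_X', Function.iterate_succ_apply']
    rfl

/-! ### The polynomials `Mir` -/

/-- The series `∑_{k ≥ 1} β_k ∂ (φ ∂) ^ (k-1) φ w ^ k`. -/
noncomputable def mirSeries : PowerSeries (MvPolynomial ℕ (MvPolynomial ℕ+ ℤ)) :=
  tailSeries fun k =>
    MvPolynomial.C (X k) * MvPolynomial.map MvPolynomial.C (jetDeriv (jetPoly (k - 1 : ℕ)))

/-- The integral differential polynomial underlying `D_{r,s}`, with `l = r + 1 - s`. -/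
noncomputable def mirPoly (s l : ℕ) : MvPolynomial ℕ (MvPolynomial ℕ+ ℤ) :=
  X 0 ^ (l - 1) * PowerSeries.coeff s (mirSeries ^ l)

/-- The coefficients of `P` are weighted homogeneous of degree `e`. -/
def HasHomogeneousCoeffs (v : ℕ+ → ℕ) (P : MvPolynomial ℕ (MvPolynomial ℕ+ ℤ)) (e : ℕ) : Prop :=
  ∀ n, (coeff n P).IsWeightedHomogeneous v e

theorem HasHomogeneousCoeffs.mul {v : ℕ+ → ℕ} {P Q : MvPolynomial ℕ (MvPolynomial ℕ+ ℤ)} {e e' : ℕ}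
    (hP : HasHomogeneousCoeffs v P e) (hQ : HasHomogeneousCoeffs v Q e') :
    HasHomogeneousCoeffs v (P * Q) (e + e') := fun n => by
  rw [coeff_mul]
  exact IsWeightedHomogeneous.sum _ _ _ fun x _ => (hP x.1).mul (hQ x.2)

theorem HasHomogeneousCoeffs.sum {ι : Type*} {v : ℕ+ → ℕ} {t : Finset ι}
    {P : ι → MvPolynomial ℕ (MvPolynomial ℕ+ ℤ)} {e : ℕ}
    (h : ∀ i ∈ t, HasHomogeneousCoeffs v (P i) e) : HasHomogeneousCoeffs v (∑ i ∈ t, P i) e :=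
  fun n => by
    rw [coeff_sum]
    exact IsWeightedHomogeneous.sum _ _ _ fun i hi => h i hi n

theorem hasHomogeneousCoeffs_map (v : ℕ+ → ℕ) (P : MvPolynomial ℕ ℤ) :
    HasHomogeneousCoeffs v (MvPolynomial.map MvPolynomial.C P) 0 := fun n => by
  rw [coeff_map]
  exact isWeightedHomogeneous_C _ _

theorem hasHomogeneousCoeffs_zero (v : ℕ+ → ℕ) (e : ℕ) : HasHomogeneousCoeffs v 0 e := fun n => by
  rw [coeff_zero]
  exact isWeightedHomogeneous_zero _ _ _

/-- Each term has l factors β_k with indices summing to s. Here c = 0 records the order s, and c = 1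
the degree s + l = r + 1. -/
theorem hasHomogeneousCoeffs_coeff_mirSeries_pow (v : ℕ+ → ℕ) (c : ℕ) (hv : ∀ k, v k = k + c)
    (s l : ℕ) : HasHomogeneousCoeffs v (PowerSeries.coeff s (mirSeries ^ l)) (s + c * l) := by
  induction l generalizing s with
  | zero =>
    rw [pow_zero, PowerSeries.coeff_one, mul_zero, add_zero]
    split_ifs with h
    · subst h
      simpa using hasHomogeneousCoeffs_map v 1
    · exact hasHomogeneousCoeffs_zero _ _
  | succ l ih =>
    rw [pow_succ, PowerSeries.coeff_mul]
    refine HasHomogeneousCoeffs.sum fun x hx => ?_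
    rw [Finset.HasAntidiagonal.mem_antidiagonal] at hx
    rcases h : x.2 with _ | k
    · rw [PowerSeries.coeff_zero_eq_constantCoeff_apply, mirSeries, constantCoeff_tailSeries,
        mul_zero]
      exact hasHomogeneousCoeffs_zero _ _
    · have h1 : HasHomogeneousCoeffs v (PowerSeries.coeff (k + 1) mirSeries) (k + 1 + c) := by
        rw [mirSeries, coeff_tailSeries_succ]
        intro n
        rw [coeff_C_mul]
        have h2 := (isWeightedHomogeneous_X ℤ v k.succPNat).mul
          (hasHomogeneousCoeffs_map v (jetDeriv (jetPoly (k.succPNat - 1 : ℕ))) n)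
        rwa [add_zero, hv, Nat.succPNat_coe] at h2
      have h3 := (ih x.1).mul h1
      convert h3 using 1
      rw [← hx, h]
      ring

theorem isWeightedHomogeneous_map {σ R S M : Type*} [CommSemiring R] [CommSemiring S]
    [AddCommMonoid M] {w : σ → M} {P : MvPolynomial σ R} {m : M} (h : P.IsWeightedHomogeneous w m)
    (F : R →+* S) : (MvPolynomial.map F P).IsWeightedHomogeneous w m := fun n hn =>
  h fun h0 => hn (by rw [coeff_map, h0, map_zero])

theorem isWeightedHomogeneous_coeff_mirSeries_pow (s l : ℕ) :
    (PowerSeries.coeff s (mirSeries ^ l)).IsWeightedHomogeneous jetWeight (s, s) := by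
  induction l generalizing s with
  | zero =>
    rw [pow_zero, PowerSeries.coeff_one]
    split_ifs with h
    · subst h; exact isWeightedHomogeneous_one _ _
    · exact isWeightedHomogeneous_zero _ _ _
  | succ l ih =>
    rw [pow_succ, PowerSeries.coeff_mul]
    refine IsWeightedHomogeneous.sum _ _ _ fun x hx => ?_
    rw [Finset.HasAntidiagonal.mem_antidiagonal] at hx
    rcases h : x.2 with _ | k
    · rw [PowerSeries.coeff_zero_eq_constantCoeff_apply, mirSeries, constantCoeff_tailSeries,
        mul_zero]
      exact isWeightedHomogeneous_zero _ _ _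
    · have h1 : (PowerSeries.coeff (k + 1) mirSeries).IsWeightedHomogeneous jetWeight
          (k + 1, k + 1) := by
        rw [mirSeries, coeff_tailSeries_succ]
        exact (isWeightedHomogeneous_map
          (isWeightedHomogeneous_jetDeriv (isWeightedHomogeneous_jetPoly k)) _).C_mul _
      have h3 := (ih x.1).mul h1
      convert h3 using 1
      rw [← hx, h]
      rfl

theorem isWeightedHomogeneous_mirPoly {s l : ℕ} (hl : 1 ≤ l) :
    (mirPoly s l).IsWeightedHomogeneous jetWeight (s + l - 1, s) := by
  have h := ((isWeightedHomogeneous_X (MvPolynomial ℕ+ ℤ) jetWeight 0).pow (l - 1)).mul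
    (isWeightedHomogeneous_coeff_mirSeries_pow s l)
  have e : (l - 1) • jetWeight 0 + (s, s) = (s + l - 1, s) := by
    ext
    · simp only [jetWeight, Prod.smul_mk, smul_eq_mul, mul_one, Prod.mk_add_mk]
      omega
    · simp [jetWeight]
  rwa [e] at h

theorem hasHomogeneousCoeffs_mirPoly (v : ℕ+ → ℕ) (c : ℕ) (hv : ∀ k, v k = k + c) (s l : ℕ) :
    HasHomogeneousCoeffs v (mirPoly s l) (s + c * l) := by
  have h := (hasHomogeneousCoeffs_map v (X 0 ^ (l - 1))).mul
    (hasHomogeneousCoeffs_coeff_mirSeries_pow v c hv s l)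
  rwa [map_pow, map_X, zero_add] at h

/-- There is no β_0, so l factors have order at least l; with l = r + 1 - s this is r ≤ 2s - 1. -/
theorem mirPoly_eq_zero {s l : ℕ} (h : s < l) : mirPoly s l = 0 := by
  rw [mirPoly, coeff_pow_eq_zero' (B := mirSeries) (constantCoeff_tailSeries _) h, mul_zero]

/-- The coefficients `Mir` of the integro-differential expansion of `mir`. -/
noncomputable def mirCoeff (n : ℕ →₀ ℕ) : MvPolynomial ℕ+ ℚ :=
  if 1 ≤ order n ∧ order n ≤ deg n then
    MvPolynomial.C ((-1) ^ (deg n + 1 - order n) / ((deg n + 1 - order n).factorial : ℚ)) *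
      MvPolynomial.map (Int.castRingHom ℚ)
        (coeff n (mirPoly (order n) (deg n + 1 - order n)))
  else 0

theorem mirCoeff_ne_zero {n : ℕ →₀ ℕ} (h : mirCoeff n ≠ 0) :
    1 ≤ order n ∧ order n ≤ deg n ∧ deg n + 1 ≤ 2 * order n := by
  unfold mirCoeff at h
  split_ifs at h with h1
  · refine ⟨h1.1, h1.2, not_lt.1 fun h2 => h ?_⟩
    rw [mirPoly_eq_zero (by omega), coeff_zero, map_zero, mul_zero]
  · exact absurd rfl h

/-- The only denominator is l!, and l ≤ s. -/
theorem mirCoeff_integral (n : ℕ →₀ ℕ) : ∃ P : MvPolynomial ℕ+ ℤ,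
    mirCoeff n = MvPolynomial.C (1 / ((order n).factorial : ℚ)) *
      MvPolynomial.map (Int.castRingHom ℚ) P := by
  by_cases h : mirCoeff n = 0
  · exact ⟨0, by rw [h, map_zero, mul_zero]⟩
  obtain ⟨h1, h2, h3⟩ := mirCoeff_ne_zero h
  obtain ⟨a, ha⟩ := Nat.factorial_dvd_factorial (show deg n + 1 - order n ≤ order n by omega)
  refine ⟨MvPolynomial.C ((-1) ^ (deg n + 1 - order n) * (a : ℤ)) *
    coeff n (mirPoly (order n) (deg n + 1 - order n)), ?_⟩
  rw [mirCoeff, if_pos ⟨h1, h2⟩, map_mul, map_C, ← mul_assoc, ← map_mul, ha]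
  congr 2
  have h4 : ((deg n + 1 - order n).factorial : ℚ) ≠ 0 := by
    exact_mod_cast (deg n + 1 - order n).factorial_ne_zero
  have h5 : (a : ℚ) ≠ 0 := by
    rintro h5
    have : a = 0 := by exact_mod_cast h5
    rw [this, mul_zero] at ha
    exact (order n).factorial_ne_zero ha
  push_cast
  simp only [eq_intCast]
  push_cast
  field_simp

theorem mirCoeff_isWeightedHomogeneous (n : ℕ →₀ ℕ) (v : ℕ+ → ℕ) (c : ℕ) (hv : ∀ k, v k = k + c) :
    (mirCoeff n).IsWeightedHomogeneous v (order n + c * (deg n + 1 - order n)) := by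
  unfold mirCoeff
  split_ifs with h
  · exact (isWeightedHomogeneous_map (hasHomogeneousCoeffs_mirPoly v c hv _ _ n) _).C_mul _
  · exact isWeightedHomogeneous_zero _ _ _

theorem mirCoeff_isWeightedHomogeneous_degree (n : ℕ →₀ ℕ) :
    (mirCoeff n).IsWeightedHomogeneous (fun i : ℕ+ => (i : ℕ) + 1) (deg n + 1) := by
  by_cases h : mirCoeff n = 0
  · rw [h]; exact isWeightedHomogeneous_zero _ _ _
  have h1 := mirCoeff_ne_zero h
  have h2 := mirCoeff_isWeightedHomogeneous n (fun i : ℕ+ => (i : ℕ) + 1) 1 fun _ => rfl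
  rwa [one_mul, show order n + (deg n + 1 - order n) = deg n + 1 by omega] at h2

theorem mirCoeff_isWeightedHomogeneous_order (n : ℕ →₀ ℕ) :
    (mirCoeff n).IsWeightedHomogeneous (fun i : ℕ+ => (i : ℕ)) (order n) := by
  have h2 := mirCoeff_isWeightedHomogeneous n (fun i : ℕ+ => (i : ℕ)) 0 fun _ => rfl
  rwa [zero_mul, add_zero] at h2

/-! ### The standard choice of `β` -/

/-- The denominator is X times an even unit v', so its inverse is an odd Laurent series. -/
theorem standardBeta_eq_zero {k : ℕ+} (hk : Even (k : ℕ)) : standardBeta k = 0 := by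
  set v : PowerSeries ℂ := PowerSeries.rescale (1 / 2 : ℂ) (PowerSeries.exp ℂ) -
      PowerSeries.rescale (-1 / 2 : ℂ) (PowerSeries.exp ℂ) with hv
  have hc : ∀ n, PowerSeries.coeff n v =
      ((1 / 2) ^ n - (-1 / 2) ^ n) * (1 / (n.factorial : ℂ)) := by
    intro n
    rw [hv, map_sub, PowerSeries.coeff_rescale, PowerSeries.coeff_rescale, PowerSeries.coeff_exp]
    simp
    ring
  set v' : PowerSeries ℂ := PowerSeries.mk fun n => PowerSeries.coeff (n + 1) v with hv'
  have hX : v = PowerSeries.X * v' := by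
    have := PowerSeries.eq_X_mul_shift_add_const v
    have h0 : PowerSeries.constantCoeff v = 0 := by
      rw [← PowerSeries.coeff_zero_eq_constantCoeff_apply, hc]; simp
    rwa [h0, map_zero, add_zero] at this
  have hc0 : PowerSeries.constantCoeff v' ≠ 0 := by
    rw [← PowerSeries.coeff_zero_eq_constantCoeff_apply, hv', PowerSeries.coeff_mk, hc]
    norm_num
  have heven : PowerSeries.rescale (-1 : ℂ) v' = v' := by
    ext n
    rw [PowerSeries.coeff_rescale, hv', PowerSeries.coeff_mk, hc]
    rcases Nat.even_or_odd n with hn | hn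
    · rw [hn.neg_one_pow, one_mul]
    · have h1 : Even (n + 1) := hn.add_one
      rw [show (-1 / 2 : ℂ) = -(1 / 2) by ring, h1.neg_pow]
      ring
  have hinv : PowerSeries.rescale (-1 : ℂ) v'⁻¹ = v'⁻¹ := by
    have h1 := congrArg (PowerSeries.rescale (-1 : ℂ)) (PowerSeries.mul_inv_cancel v' hc0)
    rw [map_mul, heven, map_one] at h1
    calc PowerSeries.rescale (-1 : ℂ) v'⁻¹
        = v'⁻¹ * v' * PowerSeries.rescale (-1 : ℂ) v'⁻¹ := by
          rw [PowerSeries.inv_mul_cancel v' hc0, one_mul]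
      _ = v'⁻¹ := by rw [mul_assoc, h1, mul_one]
  have hodd : PowerSeries.coeff ((k : ℕ) + 1) v'⁻¹ = 0 := by
    have h1 := congrArg (PowerSeries.coeff ((k : ℕ) + 1)) hinv
    rw [PowerSeries.coeff_rescale, (hk.add_one).neg_one_pow] at h1
    linear_combination -h1 / 2
  have hL : ((v : LaurentSeries ℂ))⁻¹ =
      HahnSeries.single (-1 : ℤ) (1 : ℂ) * ((v'⁻¹ : PowerSeries ℂ) : LaurentSeries ℂ) := by
    refine inv_eq_of_mul_eq_one_left ?_
    rw [hX, PowerSeries.coe_mul, PowerSeries.coe_X, mul_mul_mul_comm, HahnSeries.single_mul_single,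
      ← PowerSeries.coe_mul, PowerSeries.inv_mul_cancel v' hc0]
    simp
  rw [standardBeta, ← hv, hL, HahnSeries.coeff_single_mul, one_mul, sub_neg_eq_add]
  have h2 := LaurentSeries.coeff_coe_powerSeries v'⁻¹ ((k : ℕ) + 1)
  push_cast at h2
  rw [h2, hodd]

/-- Each monomial has odd degree r + 1, hence contains some β_i with i + 1 odd, and this β_i is
zero. -/
theorem aeval_standardBeta_mirCoeff {n : ℕ →₀ ℕ} (hn : Even (deg n)) :
    aeval standardBeta (mirCoeff n) = 0 := by
  rw [aeval_def, eval₂_eq]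
  refine Finset.sum_eq_zero fun d hd => ?_
  have h1 := mirCoeff_isWeightedHomogeneous_degree n (mem_support_iff.1 hd)
  rw [Finsupp.weight_apply, Finsupp.sum] at h1
  have h2 : ∃ i ∈ d.support, Even (i : ℕ) := by
    by_contra! h3
    have h4 : Even (∑ i ∈ d.support, d i • ((i : ℕ) + 1)) := by
      refine Finset.even_sum _ fun i hi => ?_
      rw [smul_eq_mul]
      exact (Nat.not_even_iff_odd.1 (h3 i hi)).add_one.mul_left _
    rw [h1] at h4
    exact Nat.not_even_iff_odd.2 hn.add_one h4
  obtain ⟨i, hi, hi'⟩ := h2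
  rw [Finset.prod_eq_zero hi, mul_zero]
  rw [standardBeta_eq_zero hi', zero_pow (Finsupp.mem_support_iff.1 hi)]

end MirTransform

/-! ### Existence of the expansion: rewriting e_s(g*) g in terms of ḡ. -/

namespace MirTransform

/-! ### The differential operators with coefficients `Mir` -/

/-- Evaluation of differential polynomials with coefficients in `ℤ[β]`. -/
noncomputable def evalJet (β : ℕ+ → ℂ) (φ : HahnSeries ℚ ℂ) :
    MvPolynomial ℕ (MvPolynomial ℕ+ ℤ) →+* HahnSeries ℚ ℂ :=
  MvPolynomial.eval₂Hom
    ((HahnSeries.C : ℂ →+* HahnSeries ℚ ℂ).comp (MvPolynomial.aeval β : _ →ₐ[ℤ] ℂ).toRingHom)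
    fun i => deriv^[i] φ

theorem evalJet_map (β : ℕ+ → ℂ) (φ : HahnSeries ℚ ℂ) (P : MvPolynomial ℕ ℤ) :
    evalJet β φ (MvPolynomial.map MvPolynomial.C P) =
      MvPolynomial.eval₂Hom (Int.castRingHom _) (fun i => deriv^[i] φ) P := by
  rw [evalJet, MvPolynomial.coe_eval₂Hom, MvPolynomial.eval₂_map, MvPolynomial.coe_eval₂Hom]
  congr 1
  exact RingHom.ext_int _ _

theorem evalJet_eq_sum (β : ℕ+ → ℂ) (φ : HahnSeries ℚ ℂ) {r s : ℕ}
    {P : MvPolynomial ℕ (MvPolynomial ℕ+ ℤ)} (hP : P.IsWeightedHomogeneous jetWeight (r, s)) :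
    evalJet β φ P = ∑ n ∈ multiIndices r s, MvPolynomial.aeval β (P.coeff n) •
      ∏ i ∈ Finset.range (s + 1), (deriv^[i] φ) ^ n i := by
  have hsub : P.support ⊆ multiIndices r s := fun n hn => by
    have h := hP (MvPolynomial.mem_support_iff.1 hn)
    rw [weight_jetWeight, Prod.mk.injEq] at h
    exact mem_multiIndices.2 h
  rw [evalJet, MvPolynomial.coe_eval₂Hom, MvPolynomial.eval₂_eq]
  refine (Finset.sum_subset hsub fun n _ hn => ?_).trans (Finset.sum_congr rfl fun n hn => ?_)
  · rw [MvPolynomial.notMem_support_iff.1 hn, map_zero, zero_mul]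
  · have h1 : n.support ⊆ Finset.range (s + 1) := by
      rw [multiIndices, Finset.mem_filter, Finset.mem_finsuppAntidiag] at hn
      exact hn.1.2
    rw [Finset.prod_subset h1 fun i _ hi => by
      rw [Finsupp.notMem_support_iff.1 hi, pow_zero], ← HahnSeries.C_mul_eq_smul]
    rfl

/-- The values at `β` of the coefficients `Mir`. -/
noncomputable def mirValue (β : ℕ+ → ℂ) (n : ℕ →₀ ℕ) : ℂ := MvPolynomial.aeval β (mirCoeff n)

theorem mirValue_eq (β : ℕ+ → ℂ) {n : ℕ →₀ ℕ} {r s : ℕ} (hn : n ∈ multiIndices r s)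
    (hs : 1 ≤ s) (hsr : s ≤ r) :
    mirValue β n = (-1) ^ (r + 1 - s) / ((r + 1 - s).factorial : ℂ) *
      MvPolynomial.aeval β ((mirPoly s (r + 1 - s)).coeff n) := by
  obtain ⟨rfl, rfl⟩ := mem_multiIndices.1 hn
  rw [mirValue, mirCoeff, if_pos ⟨hs, hsr⟩, map_mul, MvPolynomial.aeval_C]
  congr 1
  · simp
  · rw [MvPolynomial.aeval_def, MvPolynomial.aeval_def, MvPolynomial.eval₂_map]
    congr 1

theorem diffOp_mirValue (β : ℕ+ → ℂ) (φ : HahnSeries ℚ ℂ) {r s : ℕ} (hs : 1 ≤ s) (hsr : s ≤ r) :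
    diffOp (mirValue β) r s φ =
      HahnSeries.C ((-1) ^ (r + 1 - s) / ((r + 1 - s).factorial : ℂ)) *
      evalJet β φ (mirPoly s (r + 1 - s)) := by
  have h := isWeightedHomogeneous_mirPoly (s := s) (l := r + 1 - s) (by omega)
  rw [show s + (r + 1 - s) - 1 = r by omega] at h
  rw [evalJet_eq_sum β φ h, diffOp, Finset.mul_sum]
  refine Finset.sum_congr rfl fun n hn => ?_
  rw [mirValue_eq β hn hs hsr]
  simp only [← HahnSeries.C_mul_eq_smul]
  rw [map_mul, mul_assoc]

theorem diffOp_mirValue_eq_zero (β : ℕ+ → ℂ) (φ : HahnSeries ℚ ℂ) {r s : ℕ}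
    (h : ¬(1 ≤ s ∧ s ≤ r ∧ r + 1 ≤ 2 * s)) : diffOp (mirValue β) r s φ = 0 := by
  refine Finset.sum_eq_zero fun n hn => ?_
  obtain ⟨rfl, rfl⟩ := mem_multiIndices.1 hn
  have h0 : mirCoeff n = 0 := by
    by_contra h1
    exact h (mirCoeff_ne_zero h1)
  rw [mirValue, h0, map_zero]
  simp only [← HahnSeries.C_mul_eq_smul, map_zero, zero_mul]

theorem heval_smul (x : HahnSeries ℚ ℂ) (c : ℂ) (φ : PowerSeries ℂ) :
    PowerSeries.heval x (c • φ) = HahnSeries.C c * PowerSeries.heval x φ := by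
  rw [PowerSeries.smul_eq_C_mul, map_mul, PowerSeries.heval_C, ← HahnSeries.C_mul_eq_smul, mul_one]

/-- Substitution into power series, as a ring homomorphism. -/
noncomputable def hevalHom (x : HahnSeries ℚ ℂ) : PowerSeries ℂ →+* HahnSeries ℚ ℂ where
  toFun φ := PowerSeries.heval x φ
  map_one' := map_one _
  map_mul' := map_mul _
  map_zero' := map_zero _
  map_add' := map_add _

theorem hevalHom_apply (x : HahnSeries ℚ ℂ) (φ : PowerSeries ℂ) :
    hevalHom x φ = PowerSeries.heval x φ := rfl

theorem integ_sum {ι : Type*} (t : Finset ι) (F : ι → HahnSeries ℚ ℂ) :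
    integ (∑ i ∈ t, F i) = ∑ i ∈ t, integ (F i) := by
  ext q
  simp only [coeff_integ, HahnSeries.coeff_sum, Finset.sum_div]

theorem integ_iterate_sum {ι : Type*} (t : Finset ι) (F : ι → HahnSeries ℚ ℂ) (s : ℕ) :
    integ^[s] (∑ i ∈ t, F i) = ∑ i ∈ t, integ^[s] (F i) := by
  induction s with
  | zero => rfl
  | succ s ih => simp only [Function.iterate_succ_apply', ih, integ_sum]

theorem integ_iterate_zero (s : ℕ) : integ^[s] 0 = 0 := by
  have := integ_iterate_sum (∅ : Finset ℕ) (fun _ => 0) s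
  simpa using this

namespace IsUniformizer

variable {κ : ℕ} {f : PowerSeries ℂ} {ρ : ℂ} {gs : HahnSeries ℚ ℂ}

theorem deriv_ne_zero (h : IsUniformizer κ f ρ gs) : deriv gs ≠ 0 :=
  right_ne_zero_of_mul_eq_one h.heval_mul_deriv

theorem inv_deriv (h : IsUniformizer κ f ρ gs) : (deriv gs)⁻¹ = PowerSeries.heval gs f :=
  inv_eq_of_mul_eq_one_left h.heval_mul_deriv

theorem inv_deriv_mul_deriv_heval (h : IsUniformizer κ f ρ gs) (φ : PowerSeries ℂ) :
    (deriv gs)⁻¹ * deriv (PowerSeries.heval gs φ) =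
      PowerSeries.heval gs (PowerSeries.derivative ℂ φ) := by
  rw [deriv_heval h.pos, mul_comm, mul_assoc, mul_inv_cancel₀ h.deriv_ne_zero, mul_one]

/-- Along x = g*(y) the derivation d/dx reads ḡ ∂. -/
theorem iterate_inv_deriv (h : IsUniformizer κ f ρ gs) (k : ℕ) :
    (fun ψ => (deriv gs)⁻¹ * deriv ψ)^[k] (deriv gs)⁻¹ =
      PowerSeries.heval gs ((PowerSeries.derivative ℂ)^[k] f) := by
  induction k with
  | zero => exact h.inv_deriv
  | succ k ih =>
    rw [Function.iterate_succ_apply', ih, Function.iterate_succ_apply', h.inv_deriv_mul_deriv_heval]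

theorem map_jetSeries (h : IsUniformizer κ f ρ gs) (β : ℕ+ → ℂ) :
    PowerSeries.map (hevalHom gs) (jetSeries β f) =
      PowerSeries.C (deriv gs)⁻¹ * PowerSeries.map (evalJet β (deriv gs)⁻¹) mirSeries := by
  rw [jetSeries, mirSeries, map_tailSeries, map_tailSeries]
  ext1 k
  rw [PowerSeries.coeff_C_mul]
  rcases k with _ | k
  · rw [PowerSeries.coeff_zero_eq_constantCoeff_apply, PowerSeries.coeff_zero_eq_constantCoeff_apply,
      constantCoeff_tailSeries, constantCoeff_tailSeries, mul_zero]
  · rw [coeff_tailSeries_succ, coeff_tailSeries_succ, map_mul, evalJet_map, eval₂_jetDeriv,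
      eval₂_jetPoly, Nat.succPNat_coe, Nat.succ_sub_one, h.iterate_inv_deriv]
    have h1 := h.inv_deriv_mul_deriv_heval ((PowerSeries.derivative ℂ)^[k] f)
    rw [← Function.iterate_succ_apply' (PowerSeries.derivative ℂ)] at h1
    have h2 : evalJet β (deriv gs)⁻¹ (MvPolynomial.C (MvPolynomial.X k.succPNat)) =
        HahnSeries.C (β k.succPNat) := by
      rw [evalJet, MvPolynomial.eval₂Hom_C]
      simp
    rw [h2, mul_left_comm, h1, hevalHom_apply, heval_smul]

/-- By `map_jetSeries` each factor f^(k)(g*) contains one ḡ; of the l + 1 copies, one cancels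
against g. -/
theorem evalJet_mirPoly (h : IsUniformizer κ f ρ gs) (β : ℕ+ → ℂ) (s l : ℕ) :
    evalJet β (deriv gs)⁻¹ (mirPoly s (l + 1)) =
      PowerSeries.heval gs (PowerSeries.coeff s (jetSeries β f ^ (l + 1))) * deriv gs := by
  have h1 : PowerSeries.heval gs (PowerSeries.coeff s (jetSeries β f ^ (l + 1))) =
      (deriv gs)⁻¹ ^ (l + 1) *
        evalJet β (deriv gs)⁻¹ (PowerSeries.coeff s (mirSeries ^ (l + 1))) := by
    have h2 := congrArg (PowerSeries.coeff s) (congrArg (· ^ (l + 1)) (h.map_jetSeries β))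
    rw [mul_pow, ← map_pow, ← map_pow, ← map_pow, PowerSeries.coeff_C_mul, PowerSeries.coeff_map,
      PowerSeries.coeff_map] at h2
    exact h2
  have h3 : evalJet β (deriv gs)⁻¹ (MvPolynomial.X 0) = (deriv gs)⁻¹ := by
    rw [evalJet, MvPolynomial.eval₂Hom_X']
    rfl
  rw [h1, mirPoly, Nat.add_sub_cancel, map_mul, map_pow, h3, pow_succ (deriv gs)⁻¹]
  have h4 := mul_inv_cancel₀ h.deriv_ne_zero
  linear_combination (-(deriv gs)⁻¹ ^ l *
    evalJet β (deriv gs)⁻¹ (PowerSeries.coeff s (mirSeries ^ (l + 1)))) * h4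

theorem exists_diffOp_eq (h : IsUniformizer κ f ρ gs) (β : ℕ+ → ℂ) (r s : ℕ) :
    ∃ φ, diffOp (mirValue β) r s (deriv gs)⁻¹ = PowerSeries.heval gs φ * deriv gs := by
  by_cases hrs : 1 ≤ s ∧ s ≤ r ∧ r + 1 ≤ 2 * s
  · refine ⟨((-1) ^ (r + 1 - s) / ((r + 1 - s).factorial : ℂ)) •
      PowerSeries.coeff s (jetSeries β f ^ (r - s + 1)), ?_⟩
    have h1 := h.evalJet_mirPoly β s (r - s)
    rw [diffOp_mirValue β _ hrs.1 hrs.2.1]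
    rw [show r - s + 1 = r + 1 - s by omega] at h1 ⊢
    rw [h1, heval_smul, mul_assoc]
  · exact ⟨0, by rw [diffOp_mirValue_eq_zero β _ hrs, map_zero, zero_mul]⟩

/-- At fixed s the l-th exponential term, 1 ≤ l ≤ s, is the operator with r = s + l - 1; all other r
contribute zero. -/
theorem sum_diffOp (h : IsUniformizer κ f ρ gs) (β : ℕ+ → ℂ) {s N : ℕ} (hs : 1 ≤ s) (hN : s ≤ N) :
    ∑ r ∈ Finset.range (2 * N), diffOp (mirValue β) r s (deriv gs)⁻¹ =
      PowerSeries.heval gs (expNegCoeff (jetSeries β f) s) * deriv gs := by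
  rw [expNegCoeff, Finset.sum_range_succ', pow_zero (jetSeries β f), PowerSeries.coeff_one,
    if_neg (by omega : s ≠ 0), smul_zero, add_zero, map_sum, Finset.sum_mul]
  have h1 : ∀ l ∈ Finset.range s, PowerSeries.heval gs
      (((-1 : ℂ) ^ (l + 1) / ((l + 1).factorial : ℂ)) •
        PowerSeries.coeff s (jetSeries β f ^ (l + 1))) * deriv gs =
      diffOp (mirValue β) (s + l) s (deriv gs)⁻¹ := by
    intro l _
    rw [diffOp_mirValue β _ hs (by omega), show s + l + 1 - s = l + 1 by omega, h.evalJet_mirPoly,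
      heval_smul, mul_assoc]
  rw [Finset.sum_congr rfl h1]
  obtain ⟨M, hM⟩ := Nat.exists_eq_add_of_le (show s + s ≤ 2 * N by omega)
  rw [hM, Finset.sum_range_add, Finset.sum_range_add, Finset.sum_eq_zero (s := Finset.range s),
    zero_add, add_eq_left]
  · refine Finset.sum_eq_zero fun i _ => diffOp_mirValue_eq_zero β _ (by omega)
  · intro r hr
    rw [Finset.mem_range] at hr
    exact diffOp_mirValue_eq_zero β _ (by omega)

/-- The first two bounds leave finitely many (r, s) for each exponent; the third puts all exponents
in one discrete set bounded below. Together they give summability. -/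
theorem coeff_integ_iterate_diffOp_ne_zero (h : IsUniformizer κ f ρ gs) (β : ℕ+ → ℂ) {r s : ℕ}
    {q : ℚ} (hq : (integ^[s] (diffOp (mirValue β) r s (deriv gs)⁻¹)).coeff q ≠ 0) :
    (s : ℚ) < q + 1 ∧ r < 2 * s ∧ ∃ n : ℕ, q = ((n : ℚ) + 1) / ((κ : ℚ) + 1) - 1 := by
  have hκ0 : (κ : ℚ) + 1 ≠ 0 := Nat.cast_add_one_ne_zero κ
  obtain ⟨φ, hφ⟩ := h.exists_diffOp_eq β r s
  refine ⟨not_le.1 fun h1 => hq ?_, not_le.1 fun h1 => hq ?_, ?_⟩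
  · rw [hφ]
    refine (h.vanishesBelow_heval_mul_deriv φ).integ_iterate s q ?_
    have : (0 : ℚ) < 1 / ((κ : ℚ) + 1) := by positivity
    linarith
  · rw [diffOp_mirValue_eq_zero β _ (by omega), integ_iterate_zero, HahnSeries.coeff_zero]
  · rw [hφ, coeff_integ_iterate (h.isIntegrableAtZero φ)] at hq
    have h1 := left_ne_zero_of_mul (left_ne_zero_of_mul (div_eq_mul_inv (G := ℂ) _ _ ▸ hq))
    by_contra! h2
    refine h1 ?_
    have h3 := h.coeff_heval_mul_deriv_eq_zero φ (d := ((κ : ℚ) + 1) * (q - s + 1)) (by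
      intro n hn
      refine h2 (n + s * (κ + 1)) ?_
      push_cast
      field_simp
      linarith)
    rwa [mul_div_cancel_left₀ _ hκ0, add_sub_cancel_right] at h3

/-- The summable family of the terms of the integro-differential expansion. -/
noncomputable def mirFamily (h : IsUniformizer κ f ρ gs) (β : ℕ+ → ℂ) :
    HahnSeries.SummableFamily ℚ ℂ (ℕ × ℕ) where
  toFun a := integ^[a.2] (diffOp (mirValue β) a.1 a.2 (deriv gs)⁻¹)
  isPWO_iUnion_support' := by
    have hN : (Set.univ : Set ℕ).IsPWO := Set.isPWO_of_wellQuasiOrderedLE _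
    refine (hN.image_of_monotone
      (f := fun n : ℕ => ((n : ℚ) + 1) / ((κ : ℚ) + 1) - 1) (fun a b hab => ?_)).mono ?_
    · have : (a : ℚ) ≤ b := by exact_mod_cast hab
      dsimp only
      gcongr
    · intro q hq
      obtain ⟨⟨r, s⟩, hrs⟩ := Set.mem_iUnion.1 hq
      obtain ⟨-, -, n, hn⟩ := h.coeff_integ_iterate_diffOp_ne_zero β hrs
      exact ⟨n, Set.mem_univ _, hn.symm⟩
  finite_co_support' q := by
    obtain ⟨N, hN⟩ := exists_nat_gt (q + 1)
    refine ((Finset.range (2 * N) ×ˢ Finset.range N).finite_toSet).subset ?_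
    rintro ⟨r, s⟩ hrs
    obtain ⟨h1, h2, -⟩ := h.coeff_integ_iterate_diffOp_ne_zero β hrs
    have h3 : s < N := by exact_mod_cast h1.trans hN
    simp only [Finset.coe_product, Finset.coe_range, Set.mem_prod, Set.mem_Iio]
    omega

/-- The term s = 0 has e_0 = 1 and yields g = 1/ḡ; the orders s ≥ 1 regroup into the double sum. -/
theorem nir_eq (h : IsUniformizer κ f ρ gs) (β : ℕ+ → ℂ) :
    nir β κ f ρ = deriv gs + (h.mirFamily β).hsum := by
  ext q
  obtain ⟨N, hN⟩ := exists_nat_gt (max (((κ : ℚ) + 1) * (q + 1)) (q + 1))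
  rw [max_lt_iff] at hN
  have hsum : (h.mirFamily β).hsum.coeff q =
      ∑ s ∈ Finset.range (N + 1), ∑ r ∈ Finset.range (2 * (N + 1)),
        (integ^[s] (diffOp (mirValue β) r s (deriv gs)⁻¹)).coeff q := by
    rw [HahnSeries.SummableFamily.coeff_hsum, Finset.sum_comm, ← Finset.sum_product']
    refine finsum_eq_sum_of_support_subset _ ?_
    rintro ⟨r, s⟩ hrs
    obtain ⟨h1, h2, -⟩ := h.coeff_integ_iterate_diffOp_ne_zero β hrs
    have h3 : s < N := by exact_mod_cast h1.trans hN.2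
    simp only [Finset.coe_product, Finset.coe_range, Set.mem_prod, Set.mem_Iio]
    omega
  rw [HahnSeries.coeff_add, hsum, h.coeff_nir β (N := N + 1) (by push_cast; linarith),
    Finset.sum_range_succ', Finset.sum_range_succ', add_comm]
  have h0 : expNegCoeff (jetSeries β f) 0 = 1 := by simp [expNegCoeff]
  have h1 : ∑ r ∈ Finset.range (2 * (N + 1)),
      (integ^[0] (diffOp (mirValue β) r 0 (deriv gs)⁻¹)).coeff q = 0 :=
    Finset.sum_eq_zero fun r _ => by
      rw [diffOp_mirValue_eq_zero β _ (by omega), integ_iterate_zero, HahnSeries.coeff_zero]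
  rw [h0, h1, map_one, one_mul, add_zero]
  congr 1
  refine Finset.sum_congr rfl fun s hs => ?_
  rw [Finset.mem_range] at hs
  rw [← h.sum_diffOp β (N := N + 1) (by omega) (by omega), integ_iterate_sum, HahnSeries.coeff_sum]

end IsUniformizer

theorem isMirExpansion_mirValue (β : ℕ+ → ℂ) : IsMirExpansion β (mirValue β) := by
  refine ⟨fun n hn => ?_, ?_⟩
  · have h0 : mirCoeff n ≠ 0 := fun h0 => hn (by rw [mirValue, h0, map_zero])
    have := mirCoeff_ne_zero h0
    omega
  · rintro _ _ ⟨κ, f, ρ, gs, h1, h2, h3, h4, h5, rfl, rfl⟩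
    have h : IsUniformizer κ f ρ gs := ⟨h1, h2, h3, h4, h5⟩
    refine ⟨fun r s => ?_, h.mirFamily β, fun r s => rfl, ?_⟩
    · obtain ⟨φ, hφ⟩ := h.exists_diffOp_eq β r s
      rw [hφ]
      exact h.isIntegrableAtZero φ
    · rw [inv_inv, inv_inv, h.nir_eq β]

end MirTransform

/-! ### Uniqueness, tested on invertible power series ḡ. -/

namespace MirTransform

open HahnSeries

/-! ### Power series as Hahn series -/

theorem coeff_ofPowerSeries_eq_zero (p : PowerSeries ℂ) {q : ℚ} (hq : ∀ n : ℕ, q ≠ n) :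
    (ofPowerSeries ℚ ℂ p).coeff q = 0 := by
  rw [ofPowerSeries_apply, embDomain_of_notMem_range]
  rintro ⟨n, hn⟩
  exact hq n hn.symm

theorem vanishesBelow_ofPowerSeries (p : PowerSeries ℂ) :
    VanishesBelow (ofPowerSeries ℚ ℂ p) 0 := fun q hq =>
  coeff_ofPowerSeries_eq_zero p fun n hn => by
    have : (0 : ℚ) ≤ n := n.cast_nonneg
    linarith

theorem coeff_zero_ofPowerSeries (p : PowerSeries ℂ) :
    (ofPowerSeries ℚ ℂ p).coeff 0 = PowerSeries.constantCoeff p := by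
  have := ofPowerSeries_apply_coeff (Γ := ℚ) p 0
  rwa [Nat.cast_zero, PowerSeries.coeff_zero_eq_constantCoeff_apply] at this

theorem deriv_ofPowerSeries (p : PowerSeries ℂ) :
    deriv (ofPowerSeries ℚ ℂ p) = ofPowerSeries ℚ ℂ (PowerSeries.derivative ℂ p) := by
  ext q
  rw [coeff_deriv]
  by_cases hq : ∃ n : ℕ, q = n
  · obtain ⟨n, rfl⟩ := hq
    have := ofPowerSeries_apply_coeff (Γ := ℚ) p (n + 1)
    push_cast at this
    rw [this, ofPowerSeries_apply_coeff, PowerSeries.coeff_derivative, mul_comm]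
    push_cast
    rfl
  · push Not at hq
    rw [coeff_ofPowerSeries_eq_zero _ hq]
    by_cases h1 : q + 1 = 0
    · rw [h1]; simp
    · rw [coeff_ofPowerSeries_eq_zero, mul_zero]
      intro n hn
      rcases n with _ | n
      · exact h1 (by simpa using hn)
      · exact hq n (by push_cast at hn; linarith)

theorem iterate_deriv_ofPowerSeries (p : PowerSeries ℂ) (i : ℕ) :
    deriv^[i] (ofPowerSeries ℚ ℂ p) = ofPowerSeries ℚ ℂ ((PowerSeries.derivative ℂ)^[i] p) := by
  induction i with
  | zero => rfl
  | succ i ih => rw [Function.iterate_succ_apply', ih, deriv_ofPowerSeries,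
      Function.iterate_succ_apply']

/-! ### Regular arguments of `mir` -/

/-- The Taylor series at `x = 0` of `∂_x^k A(y(x))`, where `dy/dx = A(y)` and `y(0) = 0`. -/
noncomputable def flowSeries (A : PowerSeries ℂ) (k : ℕ) : PowerSeries ℂ :=
  PowerSeries.mk fun j => PowerSeries.constantCoeff
    ((fun ψ => A * PowerSeries.derivative ℂ ψ)^[k + j] A) / (j.factorial : ℂ)

theorem derivative_flowSeries (A : PowerSeries ℂ) (k : ℕ) :
    PowerSeries.derivative ℂ (flowSeries A k) = flowSeries A (k + 1) := by
  ext j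
  have h1 : (j : ℂ) + 1 ≠ 0 := Nat.cast_add_one_ne_zero j
  have h2 : (j.factorial : ℂ) ≠ 0 := by exact_mod_cast j.factorial_ne_zero
  rw [PowerSeries.coeff_derivative, flowSeries, flowSeries, PowerSeries.coeff_mk,
    PowerSeries.coeff_mk, Nat.factorial_succ, show k + (j + 1) = k + 1 + j by ring]
  push_cast
  field_simp

theorem constantCoeff_primitive (p : PowerSeries ℂ) :
    PowerSeries.constantCoeff (primitive p) = 0 := by
  rw [← PowerSeries.coeff_zero_eq_constantCoeff_apply, primitive, PowerSeries.coeff_mk, if_pos rfl]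

theorem vanishesBelow_ofPowerSeries_primitive (p : PowerSeries ℂ) :
    VanishesBelow (ofPowerSeries ℚ ℂ (primitive p)) 1 := by
  intro q hq
  by_cases h0 : q = 0
  · rw [h0, coeff_zero_ofPowerSeries, constantCoeff_primitive]
  · refine coeff_ofPowerSeries_eq_zero _ fun n hn => ?_
    rcases n with _ | n
    · exact h0 (by simpa using hn)
    · rw [hn] at hq
      push_cast at hq
      have : (0 : ℚ) ≤ n := n.cast_nonneg
      linarith

theorem orderTop_ofPowerSeries_primitive_pos (p : PowerSeries ℂ) :
    0 < (ofPowerSeries ℚ ℂ (primitive p)).orderTop := by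
  refine lt_of_lt_of_le ?_ (vanishesBelow_iff.1 (vanishesBelow_ofPowerSeries_primitive p))
  exact_mod_cast one_pos

/-- All k are treated at once: the defect E_k has no constant term and ∂E_k = A⁻¹ E_{k+1}, so
vanishing to order N for every k implies vanishing to order N + 1 for every k. -/
theorem heval_flowSeries {A : PowerSeries ℂ} (hA : PowerSeries.constantCoeff A ≠ 0) (k : ℕ) :
    PowerSeries.heval (ofPowerSeries ℚ ℂ (primitive A⁻¹)) (flowSeries A k) =
      ofPowerSeries ℚ ℂ ((fun ψ => A * PowerSeries.derivative ℂ ψ)^[k] A) := by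
  set gs := ofPowerSeries ℚ ℂ (primitive A⁻¹)
  have hpos : 0 < gs.orderTop := orderTop_ofPowerSeries_primitive_pos _
  set Φ : ℕ → PowerSeries ℂ := fun k => (fun ψ => A * PowerSeries.derivative ℂ ψ)^[k] A with hΦ
  set E : ℕ → HahnSeries ℚ ℂ := fun k =>
    PowerSeries.heval gs (flowSeries A k) - ofPowerSeries ℚ ℂ (Φ k) with hE
  have hderiv : ∀ k, deriv (E k) = ofPowerSeries ℚ ℂ A⁻¹ * E (k + 1) := by
    intro k
    have h1 : PowerSeries.derivative ℂ (Φ k) = A⁻¹ * Φ (k + 1) := by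
      simp only [hΦ]
      rw [Function.iterate_succ_apply', ← mul_assoc, PowerSeries.inv_mul_cancel A hA, one_mul]
    simp only [hE]
    rw [deriv_sub, deriv_heval hpos, derivative_flowSeries, deriv_ofPowerSeries,
      deriv_ofPowerSeries, derivative_primitive, h1, map_mul]
    ring
  have hzero : ∀ k, (E k).coeff 0 = 0 := by
    intro k
    simp only [hE]
    rw [coeff_sub, PowerSeries.coeff_heval_zero, coeff_zero_ofPowerSeries,
      ← PowerSeries.coeff_zero_eq_constantCoeff_apply, flowSeries, PowerSeries.coeff_mk]
    simp [hΦ]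
  have hvan : ∀ (N k : ℕ), VanishesBelow (E k) N := by
    intro N
    induction N with
    | zero =>
      intro k
      rw [Nat.cast_zero]
      exact (vanishesBelow_heval hpos _).sub (vanishesBelow_ofPowerSeries _)
    | succ N ih =>
      intro k
      rw [← integ_deriv (hzero k), hderiv]
      refine ((vanishesBelow_ofPowerSeries _).mul (ih (k + 1))).integ.mono ?_
      push_cast
      linarith
  exact sub_eq_zero.1 (eq_zero_of_forall_vanishesBelow fun N => hvan N k)

/-- Here κ = 0 and g* = ∫ 1/A. The function f is A along the flow y' = A(y), so f_0 = A(0) and ρ =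
1/A(0). -/
theorem exists_isMir_ofPowerSeries (β : ℕ+ → ℂ) {A : PowerSeries ℂ}
    (hA : PowerSeries.constantCoeff A ≠ 0) : ∃ hbar, IsMir β (ofPowerSeries ℚ ℂ A) hbar := by
  set gs := ofPowerSeries ℚ ℂ (primitive A⁻¹) with hgs
  have hpos : 0 < gs.orderTop := orderTop_ofPowerSeries_primitive_pos _
  have hg : deriv gs = ofPowerSeries ℚ ℂ A⁻¹ := by
    rw [hgs, deriv_ofPowerSeries, derivative_primitive]
  have hmul : ofPowerSeries ℚ ℂ A * ofPowerSeries ℚ ℂ A⁻¹ = 1 := by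
    rw [← map_mul, PowerSeries.mul_inv_cancel A hA, map_one]
  have hcoeff : gs.coeff 1 = (PowerSeries.constantCoeff A)⁻¹ := by
    have h1 := ofPowerSeries_apply_coeff (Γ := ℚ) (primitive A⁻¹) 1
    rw [Nat.cast_one] at h1
    rw [hgs, h1, primitive, PowerSeries.coeff_mk, if_neg one_ne_zero, Nat.sub_self,
      PowerSeries.coeff_zero_eq_constantCoeff_apply, PowerSeries.constantCoeff_inv]
    simp
  have hne : gs.coeff 1 ≠ 0 := by rw [hcoeff]; exact inv_ne_zero hA
  have hgs0 : gs ≠ 0 := fun h0 => hne (by rw [h0, coeff_zero])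
  have horder : gs.order = 1 := by
    refine le_antisymm (order_le_of_coeff_ne_zero hne) ?_
    rw [le_order_iff_forall hgs0]
    exact fun q hq => vanishesBelow_ofPowerSeries_primitive _ q hq
  refine ⟨_, 0, flowSeries A 0, (PowerSeries.constantCoeff A)⁻¹, gs, by simp, ?_, hpos, ?_, ?_, ?_,
    rfl⟩
  · rw [flowSeries, PowerSeries.coeff_mk]
    simp [hA]
  · have h1 : deriv (PowerSeries.heval gs (primitive (flowSeries A 0))) = 1 := by
      rw [deriv_heval hpos, derivative_primitive, heval_flowSeries hA, hg]
      exact hmul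
    have h2 : (PowerSeries.heval gs (primitive (flowSeries A 0))).coeff 0 = 0 := by
      rw [PowerSeries.coeff_heval_zero, constantCoeff_primitive]
    rw [← integ_deriv h2, h1]
    ext q
    rw [coeff_integ, coeff_one, coeff_single]
    by_cases hq : q = 1
    · simp [hq]
    · rw [if_neg hq, if_neg (by rwa [sub_eq_zero]), zero_div]
  · rw [leadingCoeff_eq, horder, hcoeff]
    simp
  · rw [hg]
    exact (inv_eq_of_mul_eq_one_left hmul).symm

/-! ### Uniqueness of the expansion -/

theorem diffOp_congr {c c' : (ℕ →₀ ℕ) → ℂ} {r s : ℕ} (h : ∀ n, deg n = r → order n = s → c n = c' n)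
    (φ : HahnSeries ℚ ℂ) : diffOp c r s φ = diffOp c' r s φ :=
  Finset.sum_congr rfl fun n hn => by
    rw [h n (mem_multiIndices.1 hn).1 (mem_multiIndices.1 hn).2]

theorem diffOp_ofPowerSeries (c : (ℕ →₀ ℕ) → ℂ) (r s : ℕ) (A : PowerSeries ℂ) :
    diffOp c r s (ofPowerSeries ℚ ℂ A) = ofPowerSeries ℚ ℂ (∑ n ∈ multiIndices r s,
      PowerSeries.C (c n) * ∏ i ∈ Finset.range (s + 1),
        ((PowerSeries.derivative ℂ)^[i] A) ^ n i) := by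
  rw [map_sum, diffOp]
  refine Finset.sum_congr rfl fun n _ => ?_
  rw [map_mul, map_prod, ofPowerSeries_C, C_mul_eq_smul]
  simp only [iterate_deriv_ofPowerSeries, map_pow]

/-- The b_i are the derivatives of the argument at 0, so the constant term is a generic polynomial
evaluated at a prescribed point. -/
theorem coeff_zero_diffOp (c : (ℕ →₀ ℕ) → ℂ) (r s : ℕ) (b : ℕ → ℂ) :
    (diffOp c r s (ofPowerSeries ℚ ℂ
      (PowerSeries.mk fun i => b i / (i.factorial : ℂ)))).coeff 0 =
      MvPolynomial.eval b (∑ n ∈ multiIndices r s, MvPolynomial.monomial n (c n)) := by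
  rw [diffOp_ofPowerSeries, coeff_zero_ofPowerSeries, map_sum, map_sum]
  refine Finset.sum_congr rfl fun n hn => ?_
  have h1 : n.support ⊆ Finset.range (s + 1) := by
    rw [multiIndices, Finset.mem_filter, Finset.mem_finsuppAntidiag] at hn
    exact hn.1.2
  rw [MvPolynomial.eval_monomial, Finsupp.prod_of_support_subset n h1 _ (fun i _ => pow_zero _),
    map_mul, map_prod, PowerSeries.constantCoeff_C]
  congr 1
  refine Finset.prod_congr rfl fun i _ => ?_
  rw [map_pow, PowerSeries.constantCoeff_iterate_derivative, PowerSeries.coeff_mk,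
    mul_div_cancel₀ _ (by exact_mod_cast i.factorial_ne_zero)]

theorem vanishesBelow_diffOp (c : (ℕ →₀ ℕ) → ℂ) (r s : ℕ) (A : PowerSeries ℂ) :
    VanishesBelow (diffOp c r s (ofPowerSeries ℚ ℂ A)) 0 := by
  rw [diffOp_ofPowerSeries]
  exact vanishesBelow_ofPowerSeries _

theorem eq_zero_of_eval_eq_zero {P : MvPolynomial ℕ ℂ}
    (h : ∀ b : ℕ → ℂ, b 0 ≠ 0 → MvPolynomial.eval b P = 0) : P = 0 := by
  have h1 : MvPolynomial.X 0 * P = 0 := by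
    refine MvPolynomial.funext fun b => ?_
    rw [map_mul, MvPolynomial.eval_X, map_zero]
    by_cases hb : b 0 = 0
    · rw [hb, zero_mul]
    · rw [h b hb, mul_zero]
  exact (mul_eq_zero.1 h1).resolve_left (MvPolynomial.X_ne_zero 0)

theorem IsMirExpansion.unique {β : ℕ+ → ℂ} {c c' : (ℕ →₀ ℕ) → ℂ} (hc : IsMirExpansion β c)
    (hc' : IsMirExpansion β c') : c = c' := by
  have hrange : ∀ {c : (ℕ →₀ ℕ) → ℂ}, IsMirExpansion β c →
      ∀ n, 2 * order n + 2 ≤ deg n → c n = 0 := fun h n hn => by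
    by_contra h0
    have := h.1 n h0
    omega
  suffices H : ∀ s n, order n = s → c n = c' n from funext fun n => H _ n rfl
  intro s
  induction s using Nat.strong_induction_on with
  | _ s ih =>
  -- Admissible coefficients have r ≤ 2s + 1, so the sum over r is finite. Merging all r loses
  -- nothing, because different multi-indices give different monomials.
  set P : MvPolynomial ℕ ℂ := ∑ r ∈ Finset.range (2 * s + 2),
    ((∑ n ∈ multiIndices r s, MvPolynomial.monomial n (c n)) -
      ∑ n ∈ multiIndices r s, MvPolynomial.monomial n (c' n)) with hP
  have hP0 : P = 0 := by
    refine eq_zero_of_eval_eq_zero fun b hb => ?_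
    set A : PowerSeries ℂ := PowerSeries.mk fun i => b i / (i.factorial : ℂ) with hA
    have hA0 : PowerSeries.constantCoeff A ≠ 0 := by
      rw [← PowerSeries.coeff_zero_eq_constantCoeff_apply, hA, PowerSeries.coeff_mk]
      simpa using hb
    obtain ⟨hbar, hmir⟩ := exists_isMir_ofPowerSeries β hA0
    obtain ⟨-, F, hF, hFsum⟩ := hc.2 _ _ hmir
    obtain ⟨-, F', hF', hFsum'⟩ := hc'.2 _ _ hmir
    have hsum : (F - F').hsum.coeff (s : ℚ) = 0 := by
      rw [SummableFamily.hsum_sub, add_left_cancel (hFsum.symm.trans hFsum'), sub_self, coeff_zero]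
    have hterm : ∀ r s', ((F - F') (r, s')).coeff (s : ℚ) =
        (integ^[s'] (diffOp c r s' (ofPowerSeries ℚ ℂ A))).coeff (s : ℚ) -
        (integ^[s'] (diffOp c' r s' (ofPowerSeries ℚ ℂ A))).coeff (s : ℚ) := by
      intro r s'
      rw [SummableFamily.sub_apply, coeff_sub, hF, hF']
    -- At ν^s the orders below s cancel by induction, and orders s' > s only start at ν^(s').
    have hsupp : (Function.support fun x => ((F - F') x).coeff (s : ℚ)) ⊆
        ((Finset.range (2 * s + 2)) ×ˢ {s} : Finset (ℕ × ℕ)) := by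
      rintro ⟨r, s'⟩ hx
      rw [Function.mem_support, hterm] at hx
      rcases lt_trichotomy s' s with h | h | h
      · refine absurd ?_ hx
        rw [diffOp_congr (fun n _ hn => ih s' h n hn), sub_self]
      · subst h
        rw [Finset.mem_coe, Finset.mem_product, Finset.mem_range, Finset.mem_singleton]
        refine ⟨not_le.1 fun hr => hx ?_, rfl⟩
        rw [diffOp_congr (c' := c') (fun n h1 h2 => ?_), sub_self]
        rw [hrange hc n (by omega), hrange hc' n (by omega)]
      · refine absurd ?_ hx
        have hlt : (s : ℚ) < 0 + s' := by rw [zero_add]; exact_mod_cast h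
        rw [(vanishesBelow_diffOp c r s' A).integ_iterate s' _ hlt,
          (vanishesBelow_diffOp c' r s' A).integ_iterate s' _ hlt, sub_self]
    rw [SummableFamily.coeff_hsum, finsum_eq_sum_of_support_subset _ hsupp,
      Finset.sum_product] at hsum
    simp only [Finset.sum_singleton, hterm] at hsum
    have hint : ∀ c r, IsIntegrableAtZero (diffOp c r s (ofPowerSeries ℚ ℂ A)) := fun c r =>
      (vanishesBelow_diffOp c r s A).isIntegrableAtZero (by norm_num)
    have hcoeff : ∀ c r, (integ^[s] (diffOp c r s (ofPowerSeries ℚ ℂ A))).coeff (s : ℚ) =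
        MvPolynomial.eval b (∑ n ∈ multiIndices r s, MvPolynomial.monomial n (c n)) *
          ((Real.Gamma (((0 : ℚ) : ℝ) + 1) : ℝ) : ℂ) / ((Real.Gamma (((s : ℚ) : ℝ) + 1) : ℝ) : ℂ) :=
      fun c r => by
        rw [coeff_integ_iterate (hint c r), sub_self, hA, coeff_zero_diffOp, Rat.cast_natCast,
          sub_self, Rat.cast_zero]
    simp only [hcoeff, ← sub_mul, ← sub_div, ← Finset.sum_mul, ← Finset.sum_div] at hsum
    have hG : ((Real.Gamma ((((s : ℚ) : ℝ)) + 1) : ℝ) : ℂ) ≠ 0 := by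
      have : (0 : ℝ) < ((s : ℚ) : ℝ) + 1 := by positivity
      exact_mod_cast (Real.Gamma_pos_of_pos this).ne'
    rw [div_eq_zero_iff, or_iff_left hG, mul_eq_zero, or_iff_left (by simp)] at hsum
    rw [hP, map_sum, ← hsum]
    exact Finset.sum_congr rfl fun r _ => map_sub _ _ _
  intro n hn
  by_cases hd : 2 * s + 2 ≤ deg n
  · rw [hrange hc n (by omega), hrange hc' n (by omega)]
  · have h1 := congrArg (MvPolynomial.coeff n) hP0
    rw [hP, MvPolynomial.coeff_sum, Finset.sum_eq_single (deg n)] at h1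
    · simp only [MvPolynomial.coeff_sub, MvPolynomial.coeff_sum, MvPolynomial.coeff_monomial,
        Finset.sum_ite_eq', MvPolynomial.coeff_zero] at h1
      rw [if_pos (mem_multiIndices.2 ⟨rfl, hn⟩), if_pos (mem_multiIndices.2 ⟨rfl, hn⟩)] at h1
      exact sub_eq_zero.1 h1
    · intro r _ hr
      have h2 : n ∉ multiIndices r s := fun h => hr (mem_multiIndices.1 h).1.symm
      simp only [MvPolynomial.coeff_sub, MvPolynomial.coeff_sum, MvPolynomial.coeff_monomial,
        Finset.sum_ite_eq', if_neg h2, sub_self]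
    · intro h
      exact absurd (Finset.mem_range.2 (by omega)) h

end MirTransform

theorem mainTheorem2 :
    ∃ Mir : (ℕ →₀ ℕ) → MvPolynomial ℕ+ ℚ,
      (∀ (β : ℕ+ → ℂ) (c : (ℕ →₀ ℕ) → ℂ),
        MirTransform.IsMirExpansion β c ↔ ∀ n, c n = MvPolynomial.aeval β (Mir n)) ∧
      (∀ n, ∃ P : MvPolynomial ℕ+ ℤ,
        Mir n = MvPolynomial.C (1 / ((MirTransform.order n).factorial : ℚ)) *
          MvPolynomial.map (Int.castRingHom ℚ) P) ∧
      (∀ n, (Mir n).IsWeightedHomogeneous (fun i : ℕ+ => (i : ℕ) + 1) (MirTransform.deg n + 1)) ∧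
      (∀ n, (Mir n).IsWeightedHomogeneous (fun i : ℕ+ => (i : ℕ)) (MirTransform.order n)) ∧
      (∀ n, Even (MirTransform.deg n) →
        MvPolynomial.aeval MirTransform.standardBeta (Mir n) = 0) := by
  refine ⟨MirTransform.mirCoeff, fun β c => ⟨fun hc n => ?_, fun hc => ?_⟩,
    MirTransform.mirCoeff_integral, MirTransform.mirCoeff_isWeightedHomogeneous_degree,
    MirTransform.mirCoeff_isWeightedHomogeneous_order,
    fun n hn => MirTransform.aeval_standardBeta_mirCoeff hn⟩
  · rw [hc.unique (MirTransform.isMirExpansion_mirValue β)]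
    rfl
  · rw [show c = MirTransform.mirValue β from funext hc]
    exact MirTransform.isMirExpansion_mirValue β
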